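/- **Channel.** A channel state $S_t$, $t\ge 0$, is a stationary Markov chain on a finite set $\mathcal S$, irreducible and aperiodic, with transition matrix $P$, steady-state distribution $\pi$, and $S_0\sim\pi$. In slot $t\ge1$ the erasure pattern $\underline Z_t=(Z_{1,t},Z_{2,t})\in\{0,1\}^2$ ($Z_{j,t}=1$ iff the packet sent in slot $t$ is erased at receiver $j$) has law $P_{\underline Z_t|S_t}(\cdot|S_t)$, independently over $t$ given the states. For $s\in\mathcal S$ put $\epsilon_{12}(s)=P_{\underline Z_t|S_{t-1}}(1,1|s)$, $\epsilon_1(s)=\epsilon_{12}(s)+P_{\underline Z_t|S_{t-1}}(1,0|s)$, $\epsilon_2(s)=\epsilon_{12}(s)+P_{\underline Z_t|S_{t-1}}(0,1|s)$. Let $\bar{\mathcal C}^{\rm mem}_{\rm fb+s}$ be the closure of the set of pairs $(R_1,R_2)\ge 0$ for which there are $x_s,y_s\in[0,1]$, $s\in\mathcal S$, with $$R_1\le\sum_s\pi_s(1-\epsilon_1(s))x_s,\quad R_1\le\sum_s\pi_s(1-\epsilon_{12}(s))(1-y_s),\quad R_2\le\sum_s\pi_s(1-\epsilon_2(s))y_s,\quad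 R_2\le\sum_s\pi_s(1-\epsilon_{12}(s))(1-x_s).$$ **Queue network.** For each receiver $j\in\{1,2\}$ (write $\bar j$ for the other one) there are buffers $Q_1^{(j)},Q_2^{(j)},Q_3^{(j)}$, an exit $Q_4^{(j)}$ which is always empty, and links $lm\in\{12,13,14,24,32,34\}$ from $Q^{(j)}_l$ to $Q^{(j)}_m$; $\mathcal O_l$ is the set of $m$ such that $lm$ is a link. In slot $t$ one of five actions $A_t\in\{1,\dots,5\}$ is chosen, and the link capacities are $$C_{12,t}^{(j)}=1\{A_t=j\}Z_{j,t}(1-Z_{\bar j,t}),\quad C_{13,t}^{(j)}=1\{A_t=4\}(1-Z_{1,t}Z_{2,t}),\quad C_{14,t}^{(j)}=1\{A_t=j\}(1-Z_{j,t}),$$ $$C_{24,t}^{(j)}=1\{A_t=3\}(1-Z_{j,t}),\quad C_{32,t}^{(j)}=1\{A_t=5\}Z_{j,t}(1-Z_{\bar j,t}),\quad C_{34,t}^{(j)}=1\{A_t=5\}(1-Z_{j,t}).$$ A link is activated iff its differential backlog is positive: $E_{lm,t}^{(j)}=1\{Q_{l,t}^{(j)}>Q_{m,t}^{(j)}\}$,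 and $\tilde F_{lm,t}^{(j)}=1\{Q_{l,t}^{(j)}>0\}E_{lm,t}^{(j)}C_{lm,t}^{(j)}$ packets travel on it. For $l=1,2,3$, $$Q_{l,t+1}^{(j)}=Q_{l,t}^{(j)}-\sum_{m}\tilde F_{lm,t}^{(j)}+\sum_{k}\tilde F_{kl,t}^{(j)}+1\{l=1\}B_{j,t},$$ where the external arrivals $B_{j,t}\in\{0,1\}$ are Bernoulli with $\Pr[B_{j,t}=1]=R_j$. The $B_{j,t}$ ($j=1,2$, $t\ge1$) are independent of each other, of the channel process $(S_t,\underline Z_t)_t$ and of the initial queue state $\underline Q_1$; $\underline Q_1$ is independent of the channel process, and its components have finite second moments (for instance $\underline Q_1=0$). **Policy.** In the visible case the action is a function of the current queue state and the previous channel state. The max-weight backpressure policy chooses, for $\underline Q_t=\underline q$ and $S_{t-1}=s$, an action (ties being broken by an arbitrary fixed rule) $$A_t\in\operatorname*{arg\,max}_{a\in\{1,\dots,5\}}\ \sum_{j=1}^2\sum_{l=1}^3\sum_{m\in\mathcal O_l}\big[Q_{l,t}^{(j)}-Q_{m,t}^{(j)}\big]^+\,\mathbb E\big[C_{lm,t}^{(j)}\,\big|\,A_t=a,\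 S_{t-1}=s\big],\qquad [x]^+=\max(x,0).$$ **Theorem.** If $(R_1+\delta,R_2+\delta)\in\bar{\mathcal C}^{\rm mem}_{\rm fb+s}$ for some $\delta>0$, then under this policy every queue of the network is strongly stable: $$\limsup_{n\to\infty}\frac1n\sum_{t=1}^n\mathbb E\big[Q_{l,t}^{(j)}\big]<\infty\qquad\text{for all } j\in\{1,2\},\ l\in\{1,2,3\}.$$ -/

import Mathlib

open MeasureTheory Filter
open scoped ENNReal BigOperators

namespace ErasureBroadcast

/-! ### The channel

The receivers `Rx₁`, `Rx₂` are the elements `0`, `1` of `Fin 2`. An erasure pattern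
`z : Fin 2 → Bool` has `z j = true` iff the packet is erased at receiver `j`. -/

/-- The receiver other than `j`. -/
def other (j : Fin 2) : Fin 2 := 1 - j

/-- An erasure pattern `(z₁, z₂)`. -/
abbrev Erasure := Fin 2 → Bool

/-- Aperiodicity of a chain with transition matrix `P`: for every state `s` the greatest common
divisor of the possible return times is `1`. -/
def Aperiodic {S : Type*} [Fintype S] [DecidableEq S] (P : Matrix S S ℝ) : Prop :=
  ∀ s : S, ∀ d : ℕ, (∀ n : ℕ, 0 < n → 0 < (P ^ n) s s → d ∣ n) → d = 1

/-- A two-receiver finite-state broadcast packet erasure channel with memory: the channel state is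
an irreducible aperiodic Markov chain on `S` with transition matrix `P` and steady-state
distribution `π`; in state `s` the erasure pattern has law `W s`. -/
structure Channel (S : Type*) [Fintype S] [DecidableEq S] where
  P : Matrix S S ℝ
  stochastic : P ∈ Matrix.rowStochastic ℝ S
  irreducible : P.IsIrreducible
  aperiodic : Aperiodic P
  π : S → ℝ
  π_mem : π ∈ stdSimplex ℝ S
  π_stationary : Matrix.vecMul π P = π
  W : S → Erasure → ℝ
  W_mem : ∀ s, W s ∈ stdSimplex ℝ Erasure

namespace Channel

variable {S : Type*} [Fintype S] [DecidableEq S] (ch : Channel S)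

/-- `P_{Z_t | S_{t-1}}(z | s)`: law of the erasure pattern given the previous channel state. -/
def erasureGivenPrev (s : S) (z : Erasure) : ℝ := ∑ s' : S, ch.P s s' * ch.W s' z

/-- Probability of erasure at both receivers given previous state `s`. -/
def eps12 (s : S) : ℝ := ch.erasureGivenPrev s ![true, true]

/-- Probability of erasure at `Rx₁` only given previous state `s`. -/
def eps1not2 (s : S) : ℝ := ch.erasureGivenPrev s ![true, false]

/-- Probability of erasure at `Rx₂` only given previous state `s`. -/
def epsNot12 (s : S) : ℝ := ch.erasureGivenPrev s ![false, true]

/-- Probability of erasure at `Rx₁` given previous state `s`. -/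
def eps1 (s : S) : ℝ := ch.eps12 s + ch.eps1not2 s

/-- Probability of erasure at `Rx₂` given previous state `s`. -/
def eps2 (s : S) : ℝ := ch.eps12 s + ch.epsNot12 s

/-- The rate region of the channel with feedback and visible state. -/
def region : Set (ℝ × ℝ) :=
  closure {R : ℝ × ℝ | 0 ≤ R.1 ∧ 0 ≤ R.2 ∧ ∃ x y : S → ℝ,
    (∀ s, 0 ≤ x s ∧ x s ≤ 1) ∧ (∀ s, 0 ≤ y s ∧ y s ≤ 1) ∧
    R.1 ≤ ∑ s, ch.π s * (1 - ch.eps1 s) * x s ∧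
    R.1 ≤ ∑ s, ch.π s * (1 - ch.eps12 s) * (1 - y s) ∧
    R.2 ≤ ∑ s, ch.π s * (1 - ch.eps2 s) * y s ∧
    R.2 ≤ ∑ s, ch.π s * (1 - ch.eps12 s) * (1 - x s)}

end Channel

/-! ### The virtual queue network -/

/-- The buffers `Q₁`, `Q₂`, `Q₃` that each receiver's network consists of, besides the exit `Q₄`,
which is empty by definition. -/
inductive Buffer
  | q1 | q2 | q3
  deriving DecidableEq

instance : Fintype Buffer := ⟨{.q1, .q2, .q3}, by intro l; cases l <;> simp⟩

/-- The links `l → m` of the network of one receiver. -/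
inductive Link
  | l12 | l13 | l14 | l24 | l32 | l34
  deriving DecidableEq

instance : Fintype Link :=
  ⟨{.l12, .l13, .l14, .l24, .l32, .l34}, by intro e; cases e <;> simp⟩

/-- Buffer a link starts from. -/
def Link.src : Link → Buffer
  | .l12 | .l13 | .l14 => .q1
  | .l24 => .q2
  | .l32 | .l34 => .q3

/-- Buffer a link leads to; `none` is the exit `Q₄`. -/
def Link.dst : Link → Option Buffer
  | .l12 | .l32 => some .q2
  | .l13 => some .q3
  | .l14 | .l24 | .l34 => none

/-- The five actions: `uncoded 0`, `uncoded 1`, `reactive`, `poison`, `remedy` are the actions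
`1`, `2`, `3`, `4`, `5`. -/
inductive Action
  | uncoded (j : Fin 2)
  | reactive
  | poison
  | remedy
  deriving DecidableEq

/-- A queue state: the number of packets in each of the six buffers. -/
abbrev QueueState := Fin 2 → Buffer → ℕ

/-- Number of packets at a node of the network of receiver `j`; it is `0` at the exit. -/
def backlog (q : QueueState) (j : Fin 2) : Option Buffer → ℕ
  | some l => q j l
  | none => 0

/-- Link capacity `C_{lm,t}^{(j)}`, a function of the action and the erasure pattern. -/
def capacity (a : Action) (z : Erasure) (j : Fin 2) : Link → ℕ
  | .l12 => if a = .uncoded j ∧ z j = true ∧ z (other j) = false then 1 else 0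
  | .l13 => if a = .poison ∧ ¬ (z 0 = true ∧ z 1 = true) then 1 else 0
  | .l14 => if a = .uncoded j ∧ z j = false then 1 else 0
  | .l24 => if a = .reactive ∧ z j = false then 1 else 0
  | .l32 => if a = .remedy ∧ z j = true ∧ z (other j) = false then 1 else 0
  | .l34 => if a = .remedy ∧ z j = false then 1 else 0

/-- Link activation `E_{lm,t}^{(j)}` of the backpressure policy: a link is used iff its
differential backlog is positive. -/
def activation (q : QueueState) (j : Fin 2) (e : Link) : ℕ :=
  if backlog q j e.dst < q j e.src then 1 else 0

/-- Service rate `F_{lm,t}^{(j)}`. -/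
def service (q : QueueState) (a : Action) (z : Erasure) (j : Fin 2) (e : Link) : ℕ :=
  activation q j e * capacity a z j e

/-- Number of packets that actually travel on the link: the service rate, unless the source buffer
is empty. -/
def flow (q : QueueState) (a : Action) (z : Erasure) (j : Fin 2) (e : Link) : ℕ :=
  (if 0 < q j e.src then 1 else 0) * service q a z j e

/-- Packets leaving buffer `l` of receiver `j`. -/
def outflow (q : QueueState) (a : Action) (z : Erasure) (j : Fin 2) (l : Buffer) : ℕ :=
  ∑ e : Link, if e.src = l then flow q a z j e else 0

/-- Packets moved into buffer `l` of receiver `j` from other buffers. -/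
def inflow (q : QueueState) (a : Action) (z : Erasure) (j : Fin 2) (l : Buffer) : ℕ :=
  ∑ e : Link, if e.dst = some l then flow q a z j e else 0

/-- External arrivals: a new packet for receiver `j` enters buffer `Q₁`. -/
def arrival (b : Fin 2 → Bool) (j : Fin 2) (l : Buffer) : ℕ :=
  if l = .q1 ∧ b j = true then 1 else 0

/-- One slot of the queue dynamics. -/
def nextQueue (q : QueueState) (a : Action) (z : Erasure) (b : Fin 2 → Bool) : QueueState :=
  fun j l => q j l - outflow q a z j l + inflow q a z j l + arrival b j l

/-- A buffer never releases more packets than it holds, so the subtraction in `nextQueue` is never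
truncated. -/
theorem outflow_le (q : QueueState) (a : Action) (z : Erasure) (j : Fin 2) (l : Buffer) :
    outflow q a z j l ≤ q j l := by
  rcases Nat.eq_zero_or_pos (q j l) with h | h
  · unfold outflow
    rw [h, Nat.le_zero, Finset.sum_eq_zero]
    intro e _
    by_cases he : e.src = l
    · subst he; simp [flow, h]
    · simp [he]
  · refine le_trans ?_ h
    have hle : ∀ e, flow q a z j e ≤ capacity a z j e := by
      intro e
      unfold flow service activation
      split_ifs <;> simp
    have hsum : outflow q a z j l ≤ ∑ e : Link, if e.src = l then capacity a z j e else 0 := by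
      refine Finset.sum_le_sum fun e _ => ?_
      split_ifs
      · exact hle e
      · exact le_rfl
    refine hsum.trans ?_
    have hu : (Finset.univ : Finset Link) = {.l12, .l13, .l14, .l24, .l32, .l34} := rfl
    rw [hu]
    cases l <;> cases a <;> cases hz : z j <;>
      simp [Link.src, capacity, hz] <;> split_ifs <;> simp

/-! ### The max-weight policy -/

section Policy

variable {S : Type*} [Fintype S] [DecidableEq S] (ch : Channel S)

/-- Expected capacity of a link under action `a`, given the previous channel state `s`. -/
noncomputable def expectedCapacity (s : S) (a : Action) (j : Fin 2) (e : Link) : ℝ :=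
  ∑ z : Erasure, ch.erasureGivenPrev s z * (capacity a z j e : ℝ)

/-- Weight of action `a` in queue state `q` when the previous channel state is `s`: the sum over
all links of the positive part of the differential backlog times the expected link capacity. -/
noncomputable def weight (q : QueueState) (s : S) (a : Action) : ℝ :=
  ∑ j : Fin 2, ∑ e : Link,
    max ((q j e.src : ℝ) - (backlog q j e.dst : ℝ)) 0 * expectedCapacity ch s a j e

/-- The map `act` always picks an action of maximal weight (ties are broken arbitrarily). -/
def IsMaxWeight (act : QueueState → S → Action) : Prop :=
  ∀ q s a, weight ch q s a ≤ weight ch q s (act q s)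

end Policy

/-! ### The random system -/

/-- The queue state `Q_t` at the beginning of slot `t = 1, 2, …` when the initial queue state is
`q₁` and the channel states, erasures and arrivals are `s`, `z`, `b`; the action in slot `t`
is `act Q_t S_{t-1}`. (The value at `t = 0` is a dummy.) -/
def queue {S : Type*} (act : QueueState → S → Action) (q₁ : QueueState)
    (s : ℕ → S) (z : ℕ → Erasure) (b : ℕ → Fin 2 → Bool) : ℕ → QueueState
  | 0 => q₁
  | 1 => q₁
  | t + 2 =>
    let q := queue act q₁ s z b (t + 1)
    nextQueue q (act q (s t)) (z (t + 1)) (b (t + 1))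

/-- Joint law of the exogenous random variables: channel states `St t` (`t ≥ 0`), erasures `Z t`
and arrivals `B t` (`t ≥ 1`), and the initial queue state `Q₁`. The states form the stationary
Markov chain of the channel, given the states the erasure patterns are independent with
laws `W (St t)`, packets for receiver `j` arrive according to a Bernoulli process with
probability `R j`, and the arrival processes, the channel and the initial queue state are
independent. -/
structure IsSystem {S : Type*} [Fintype S] [DecidableEq S] (ch : Channel S) (R : Fin 2 → ℝ)
    {Ω : Type*} [MeasurableSpace Ω] (μ : Measure Ω) (Q₁ : Ω → QueueState)
    (St : ℕ → Ω → S) (Z : ℕ → Ω → Erasure) (B : ℕ → Ω → Fin 2 → Bool) : Prop where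
  measurable_Q₁ : ∀ q, MeasurableSet {ω | Q₁ ω = q}
  measurable_St : ∀ t s, MeasurableSet {ω | St t ω = s}
  measurable_Z : ∀ t z, MeasurableSet {ω | Z t ω = z}
  measurable_B : ∀ t b, MeasurableSet {ω | B t ω = b}
  law : ∀ (n : ℕ) (q : QueueState) (s : ℕ → S) (z : ℕ → Erasure) (b : ℕ → Fin 2 → Bool),
    μ.real {ω | Q₁ ω = q ∧ St 0 ω = s 0 ∧ ∀ t < n,
        St (t + 1) ω = s (t + 1) ∧ Z (t + 1) ω = z (t + 1) ∧ B (t + 1) ω = b (t + 1)} =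
      μ.real {ω | Q₁ ω = q} * ch.π (s 0) *
        ∏ t ∈ Finset.range n, (ch.P (s t) (s (t + 1)) * ch.W (s (t + 1)) (z (t + 1)) *
          ∏ j : Fin 2, (if b (t + 1) j = true then R j else 1 - R j))

/-- Strong stability of a queue with `X t` packets at time `t = 1, 2, …`:
the limsup of the time averages of the expected backlogs is finite. -/
def StronglyStable {Ω : Type*} [MeasurableSpace Ω] (μ : Measure Ω) (X : ℕ → Ω → ℕ) : Prop :=
  limsup (fun n : ℕ => (∑ t ∈ Finset.Icc 1 n, ∫⁻ ω, (X t ω : ℝ≥0∞) ∂μ) / (n : ℝ≥0∞)) atTop < ⊤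

end ErasureBroadcast

/-!
The proof is a Foster–Lyapunov drift argument in which the memory of the channel is removed by a
corrector that solves Poisson's equation.

*A schedule that knows the channel only.* Time-sharing parameters `x`, `y` of the rate region are
turned into probabilities `p s a` of the actions given the previous channel state
(`exists_balanced_schedule`). The point is to poison and to remedy at the same rate: packets then
enter and leave `q3` equally fast, and for each receiver the four cuts between `q1` and the exit are
worth as much as the two inequalities of the region that involve this receiver
(`cutsGe_of_balanced`). Mixing in the actions that empty `q2` and `q3` with a small probability
gives a margin `ε` at every buffer (`exists_schedule`). No flow has to be constructed from the cuts:
the sum of the mean link rates times the positive differential backlogs is an integral of cut values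
over the level sets of the backlog, hence at least `R j * q j .q1` plus a multiple of the total
backlog (`le_sum_mul_posPart_of_cuts`).

*Drift.* Links are activated only at positive differential backlog, so the drift of the sum of the
squared backlogs is at most a constant plus `2 * ∑ j, R j * q j .q1` minus twice the weight of the
chosen action (`sumSq_nextQueue_le`), and a max-weight action has at least the weight of the schedule
`p` (`sum_pressure_mul_linkRate_le`). That weight depends on the previous channel state, whereas the
cut bound is about its steady-state mean. The difference telescopes in expectation: the chain being
irreducible, there is `h ≥ 0` with `P h - h` equal to the link rate minus its mean
(`Channel.exists_poisson`), and adding `2 * ∑ j, ∑ e, pressure q j e * h j e s` to the quadratic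
function replaces the rates by their means. The price is bounded, because differential backlogs change
by a bounded amount per slot (`slotMean_lyapunov_le`, `exists_lyapunov`).

*Expectations.* The finite-dimensional laws say that the next input depends on the history through
the last channel state only, which makes the drift inequality one between expectations
(`IsSystem.lintegral_queue_succ`). Since the Lyapunov function is nonnegative, everything takes place
in `ℝ≥0∞`, and finite second moments are needed for the initial state alone. Summing over time
gives the bound on the averages (`stronglyStable_of_drift`).
-/

namespace ErasureBroadcast

/-! ### Poisson's equation for an irreducible finite chain -/

/-- A function that is harmonic for an irreducible stochastic matrix is constant: the maximum
principle, applied to the powers of the matrix. -/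
theorem eq_of_mulVec_eq_self {S : Type*} [Fintype S] [DecidableEq S] {P : Matrix S S ℝ}
    (hP : P ∈ Matrix.rowStochastic ℝ S) (hirr : P.IsIrreducible) {h : S → ℝ}
    (hh : P.mulVec h = h) (s s' : S) : h s = h s' := by
  have : Nonempty S := ⟨s⟩
  obtain ⟨m, hm⟩ := Finite.exists_max h
  suffices key : ∀ j, h j = h m by rw [key s, key s']
  intro j
  obtain ⟨n, -, hn⟩ :=
    (Matrix.isIrreducible_iff_exists_pow_pos (fun i j => hP.1 i j)).1 hirr m j
  have hPn : P ^ n ∈ Matrix.rowStochastic ℝ S := pow_mem hP n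
  have hharm : (P ^ n).mulVec h = h := by
    clear hn hPn
    induction n with
    | zero => simp
    | succ n ih => rw [pow_succ, ← Matrix.mulVec_mulVec, hh, ih]
  have hsum : ∑ i, (P ^ n) m i * (h m - h i) = 0 := by
    have h1 : ∑ i, (P ^ n) m i = 1 := Matrix.sum_row_of_mem_rowStochastic hPn m
    have h2 : ∑ i, (P ^ n) m i * h i = h m := congrFun hharm m
    simp only [mul_sub, Finset.sum_sub_distrib, ← Finset.sum_mul, h1, h2]
    ring
  have hz := (Finset.sum_eq_zero_iff_of_nonneg fun i _ =>
    mul_nonneg (hPn.1 m i) (sub_nonneg.2 (hm i))).1 hsum j (Finset.mem_univ j)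
  rcases mul_eq_zero.1 hz with h0 | h0
  · exact absurd h0 hn.ne'
  · linarith

/-- Poisson's equation: a function on the states, recentred at its steady-state mean, is in the
range of `P - 1`. The harmonic functions are the constants, so this range has codimension at most
one, and it lies in the hyperplane of the functions of mean zero. The solution can be taken
nonnegative because constants may be added to it. -/
theorem Channel.exists_poisson {S : Type*} [Fintype S] [DecidableEq S] (ch : Channel S)
    (c : S → ℝ) : ∃ h : S → ℝ, (∀ s, 0 ≤ h s) ∧
      ∀ s, ∑ s', ch.P s s' * h s' - h s = c s - ∑ s', ch.π s' * c s' := by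
  classical
  have hπ1 : ∑ s, ch.π s = 1 := ch.π_mem.2
  have hP1 : ∀ s, ∑ s', ch.P s s' = 1 := Matrix.sum_row_of_mem_rowStochastic ch.stochastic
  have hne : Nonempty S := by
    by_contra hS
    rw [not_nonempty_iff] at hS
    simp at hπ1
  let T : (S → ℝ) →ₗ[ℝ] (S → ℝ) := ch.P.mulVecLin - LinearMap.id
  let φ : (S → ℝ) →ₗ[ℝ] ℝ := dotProductBilin ℝ ℝ ch.π
  have hφ : ∀ v, φ v = ∑ s, ch.π s * v s := fun v => rfl
  have hker : LinearMap.ker T ≤ Submodule.span ℝ {fun _ => (1 : ℝ)} := by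
    intro v hv
    have hv' : ch.P.mulVec v = v := by
      have : ch.P.mulVec v - v = 0 := hv
      exact sub_eq_zero.1 this
    obtain ⟨s₀⟩ := hne
    refine Submodule.mem_span_singleton.2 ⟨v s₀, ?_⟩
    ext s
    simpa using eq_of_mulVec_eq_self ch.stochastic ch.irreducible hv' s₀ s
  have hrange : LinearMap.range T ≤ LinearMap.ker φ := by
    rintro _ ⟨v, rfl⟩
    have h1 : ch.π ⬝ᵥ ch.P.mulVec v = ch.π ⬝ᵥ v := by
      rw [Matrix.dotProduct_mulVec, ch.π_stationary]
    change ch.π ⬝ᵥ (ch.P.mulVec v - v) = 0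
    rw [dotProduct_sub, h1, sub_self]
  have hφ1 : LinearMap.range φ = ⊤ := by
    rw [LinearMap.range_eq_top]
    intro r
    refine ⟨fun _ => r, ?_⟩
    rw [hφ, ← Finset.sum_mul, hπ1, one_mul]
  have heq : LinearMap.range T = LinearMap.ker φ := by
    refine Submodule.eq_of_le_of_finrank_le hrange ?_
    have e1 := LinearMap.finrank_range_add_finrank_ker T
    have e2 := LinearMap.finrank_range_add_finrank_ker φ
    have e3 : Module.finrank ℝ (LinearMap.ker T) ≤ 1 :=
      (Submodule.finrank_mono hker).trans
        (by simpa using finrank_span_le_card (R := ℝ) {fun _ : S => (1 : ℝ)})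
    rw [hφ1, finrank_top, Module.finrank_self] at e2
    omega
  have hc : (fun s => c s - ∑ s', ch.π s' * c s') ∈ LinearMap.ker φ := by
    rw [LinearMap.mem_ker, hφ]
    simp only [mul_sub, Finset.sum_sub_distrib, ← Finset.sum_mul, hπ1]
    ring
  rw [← heq] at hc
  obtain ⟨h, hh⟩ := hc
  obtain ⟨m, hm⟩ := Finite.exists_min h
  refine ⟨fun s => h s - h m, fun s => sub_nonneg.2 (hm s), fun s => ?_⟩
  have := congrFun hh s
  have hs : ∑ s', ch.P s s' * h s' - h s = c s - ∑ s', ch.π s' * c s' := this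
  simp only [mul_sub, Finset.sum_sub_distrib, ← Finset.sum_mul, hP1]
  linarith

/-! ### Cuts of the queue network -/

/-- The co-area form of weak duality between flows and cuts, for the network of one receiver with
link rates `c` and backlogs `q`: the sum of `c e` times the positive differential backlogs
is the integral over `τ > 0` of the value of the cut `{l | q l > τ}`. If the cuts that contain `q1`
are worth at least `r + ε` and the others at least `ε`, this is at least `r * q .q1` plus `ε` times
the largest backlog. -/
theorem le_sum_mul_posPart_of_cuts {c : Link → ℝ} (hc : ∀ e, 0 ≤ c e) {r ε : ℝ} (hε : 0 ≤ ε)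
    (h1 : r + ε ≤ c .l12 + c .l13 + c .l14) (h12 : r + ε ≤ c .l13 + c .l14 + c .l24)
    (h13 : r + ε ≤ c .l12 + c .l14 + c .l32 + c .l34)
    (h123 : r + ε ≤ c .l14 + c .l24 + c .l34) (h2 : ε ≤ c .l24) (h3 : ε ≤ c .l34)
    (q : QueueState) (j : Fin 2) :
    r * q j .q1 + ε / 3 * ∑ l, (q j l : ℝ) ≤
      ∑ e : Link, max ((q j e.src : ℝ) - (backlog q j e.dst : ℝ)) 0 * c e := by
  have hu : (Finset.univ : Finset Link) = {.l12, .l13, .l14, .l24, .l32, .l34} := rfl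
  have hb : (Finset.univ : Finset Buffer) = {.q1, .q2, .q3} := rfl
  have e1 : (∑ l, (q j l : ℝ)) = q j .q1 + q j .q2 + q j .q3 := by
    rw [hb]; simp [add_assoc]
  rw [hu, e1]
  simp only [Link.src, Link.dst, backlog, Finset.mem_insert, Finset.mem_singleton, reduceCtorEq,
    or_self, not_false_eq_true, Finset.sum_insert, Finset.sum_singleton, Nat.cast_zero, sub_zero]
  have p1 : (0 : ℝ) ≤ q j .q1 := Nat.cast_nonneg _
  have p2 : (0 : ℝ) ≤ q j .q2 := Nat.cast_nonneg _
  have p3 : (0 : ℝ) ≤ q j .q3 := Nat.cast_nonneg _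
  generalize (q j .q1 : ℝ) = a at *
  generalize (q j .q2 : ℝ) = b at *
  generalize (q j .q3 : ℝ) = d at *
  have c12 := hc .l12
  have c13 := hc .l13
  have c32 := hc .l32
  rw [max_eq_left p1, max_eq_left p2, max_eq_left p3]
  rcases le_total a b with hab | hab <;> rcases le_total a d with had | had <;>
    rcases le_total b d with hbd | hbd
  all_goals
    first
    | rw [max_eq_left (sub_nonneg.2 hab)]
    | rw [max_eq_right (sub_nonpos.2 hab)]
  all_goals
    first
    | rw [max_eq_left (sub_nonneg.2 had)]
    | rw [max_eq_right (sub_nonpos.2 had)]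
  all_goals
    first
    | rw [max_eq_left (sub_nonneg.2 hbd)]
    | rw [max_eq_right (sub_nonpos.2 hbd)]
  all_goals
    have z1 := sub_nonneg.2 hab
    have z2 := sub_nonneg.2 had
    have z3 := sub_nonneg.2 hbd
  -- In each of the orders of the backlogs, the levels between consecutive backlogs are multiplied
  -- by the cut that they belong to.
  · nlinarith [mul_le_mul_of_nonneg_left h123 p1, mul_nonneg z1 (sub_nonneg.2 h2),
      mul_nonneg z2 (sub_nonneg.2 h3), mul_nonneg z3 c32, mul_nonneg z1 hε, mul_nonneg z2 hε,
      mul_nonneg z3 hε]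
  · nlinarith [mul_le_mul_of_nonneg_left h123 p1, mul_nonneg z1 (sub_nonneg.2 h2),
      mul_nonneg z2 (sub_nonneg.2 h3), mul_nonneg z3 c32, mul_nonneg z1 hε, mul_nonneg z2 hε,
      mul_nonneg z3 hε]
  · nlinarith [mul_le_mul_of_nonneg_left h123 p3, mul_le_mul_of_nonneg_left h12 z2,
      mul_nonneg z1 (sub_nonneg.2 h2), mul_nonneg z1 hε, mul_nonneg z2 hε, mul_nonneg z3 hε]
  · nlinarith [mul_le_mul_of_nonneg_left h123 p3, mul_le_mul_of_nonneg_left h12 z2,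
      mul_nonneg z1 (sub_nonneg.2 h2), mul_nonneg z1 hε, mul_nonneg z2 hε, mul_nonneg z3 hε]
  · nlinarith [mul_le_mul_of_nonneg_left h123 p2, mul_le_mul_of_nonneg_left h13 z1,
      mul_nonneg z2 (sub_nonneg.2 h3), mul_nonneg z2 c32, mul_nonneg z1 hε, mul_nonneg z2 hε,
      mul_nonneg z3 hε]
  · nlinarith [mul_le_mul_of_nonneg_left h123 p2, mul_le_mul_of_nonneg_left h13 z1,
      mul_nonneg z2 (sub_nonneg.2 h3), mul_nonneg z2 c32, mul_nonneg z1 hε, mul_nonneg z2 hε,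
      mul_nonneg z3 hε]
  · nlinarith [mul_le_mul_of_nonneg_left h123 p2, mul_le_mul_of_nonneg_left h13 z3,
      mul_le_mul_of_nonneg_left h1 z2, mul_nonneg z1 hε, mul_nonneg z2 hε, mul_nonneg z3 hε]
  · nlinarith [mul_le_mul_of_nonneg_left h123 p3, mul_le_mul_of_nonneg_left h12 z3,
      mul_le_mul_of_nonneg_left h1 z1, mul_nonneg z1 hε, mul_nonneg z2 hε, mul_nonneg z3 hε]

/-! ### Time-sharing parameters and action probabilities -/

/-- Given time-sharing parameters `x`, `y` from the rate region and weights `w ≥ 0` on the states,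
there are probabilities of the actions that deliver packets as often as `x` and `y` do,
that take packets out of the two buffers `q1` as fast as required, and under which poisoning and
remedying occur at the same `w`-rate. -/
theorem exists_balanced_schedule {S : Type*} [Fintype S] {w x y : S → ℝ} (hw : ∀ s, 0 ≤ w s)
    (hx : ∀ s, 0 ≤ x s ∧ x s ≤ 1) (hy : ∀ s, 0 ≤ y s ∧ y s ≤ 1) {r : Fin 2 → ℝ}
    (h0y : r 0 ≤ ∑ s, w s * (1 - y s))
    (h1y : r 1 ≤ ∑ s, w s * y s) (h1x : r 1 ≤ ∑ s, w s * (1 - x s)) :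
    ∃ p : S → Action → ℝ, (∀ s a, 0 ≤ p s a) ∧
      (∀ s, p s (.uncoded 0) + p s (.uncoded 1) + p s .reactive + p s .poison + p s .remedy = 1) ∧
      (∀ s, x s ≤ p s (.uncoded 0) + p s .reactive + p s .remedy) ∧
      (∀ s, y s ≤ p s (.uncoded 1) + p s .reactive + p s .remedy) ∧
      (∀ j, r j ≤ ∑ s, w s * (p s (.uncoded j) + p s .poison)) ∧
      ∑ s, w s * p s .poison = ∑ s, w s * p s .remedy := by
  set m : S → ℝ := fun s => max (x s + y s - 1) 0 with hm
  set n : S → ℝ := fun s => max (1 - x s - y s) 0 with hn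
  have hmn : ∀ s, m s - n s = x s + y s - 1 := by
    intro s
    simp only [hm, hn]
    rcases le_total (x s + y s) 1 with h | h
    · rw [max_eq_right (by linarith), max_eq_left (by linarith)]; ring
    · rw [max_eq_left (by linarith), max_eq_right (by linarith)]; ring
  have hm0 : ∀ s, 0 ≤ m s := fun s => le_max_right _ _
  have hn0 : ∀ s, 0 ≤ n s := fun s => le_max_right _ _
  have hnx : ∀ s, n s ≤ 1 - x s := fun s => max_le (by linarith [hy s]) (by linarith [hx s])
  have hny : ∀ s, n s ≤ 1 - y s := fun s => max_le (by linarith [hx s]) (by linarith [hy s])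
  set M := ∑ s, w s * m s with hM
  set N := ∑ s, w s * n s with hN
  have hM0 : 0 ≤ M := Finset.sum_nonneg fun s _ => mul_nonneg (hw s) (hm0 s)
  have hN0 : 0 ≤ N := Finset.sum_nonneg fun s _ => mul_nonneg (hw s) (hn0 s)
  rcases le_or_gt N M with hNM | hNM
  · -- Poison only in the states with `x + y < 1`, and remedy at the same total rate.
    obtain ⟨k, hk0, hk1, hk⟩ : ∃ k : ℝ, 0 ≤ k ∧ k ≤ 1 ∧ k * M = N := by
      rcases hM0.eq_or_lt with h | h
      · exact ⟨0, le_rfl, zero_le_one, by linarith⟩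
      · exact ⟨N / M, by positivity, (div_le_one h).2 hNM, div_mul_cancel₀ _ h.ne'⟩
    let p : S → Action → ℝ := fun s a => match a with
      | .uncoded 0 => 1 - y s - n s
      | .uncoded 1 => 1 - x s - n s
      | .reactive => (1 - k) * m s
      | .poison => n s
      | .remedy => k * m s
    refine ⟨p, ?_, ?_, ?_, ?_, ?_, ?_⟩
    · rintro s (j | _ | _ | _)
      · fin_cases j
        · exact sub_nonneg.2 (hny s)
        · exact sub_nonneg.2 (hnx s)
      · exact mul_nonneg (sub_nonneg.2 hk1) (hm0 s)
      · exact hn0 s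
      · exact mul_nonneg hk0 (hm0 s)
    · intro s; simp only [p]; linarith [hmn s]
    · intro s; simp only [p]; linarith [hmn s]
    · intro s; simp only [p]; linarith [hmn s]
    · intro j
      fin_cases j
      · simpa [p] using h0y
      · simpa [p] using h1x
    · simp only [p, mul_left_comm (w _) k, ← Finset.mul_sum]
      exact hk.symm
  · -- The states with `x + y < 1` dominate, so that `r 1 ≤ ∑ w * y < ∑ w * (1 - x)`. This slack
    -- allows raising `x` to `x + (1 - k) * n`, where `k` restores the balance.
    obtain ⟨k, hk0, hk1, hk⟩ : ∃ k : ℝ, 0 ≤ k ∧ k ≤ 1 ∧ k * N = M := by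
      have h := hM0.trans_lt hNM
      exact ⟨M / N, by positivity, (div_le_one h).2 hNM.le, div_mul_cancel₀ _ h.ne'⟩
    let p : S → Action → ℝ := fun s a => match a with
      | .uncoded 0 => 1 - y s - k * n s
      | .uncoded 1 => 1 - x s - n s
      | .reactive => 0
      | .poison => k * n s
      | .remedy => m s
    have hkn : ∀ s, k * n s ≤ n s := fun s => mul_le_of_le_one_left (hn0 s) hk1
    refine ⟨p, ?_, ?_, ?_, ?_, ?_, ?_⟩
    · rintro s (j | _ | _ | _)
      · fin_cases j
        · exact sub_nonneg.2 ((hkn s).trans (hny s))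
        · exact sub_nonneg.2 (hnx s)
      · exact le_rfl
      · exact mul_nonneg hk0 (hn0 s)
      · exact hm0 s
    · intro s; simp only [p]; linarith [hmn s]
    · intro s; simp only [p]; linarith [hmn s, hkn s]
    · intro s; simp only [p]; linarith [hmn s]
    · intro j
      fin_cases j
      · simpa [p] using h0y
      · have e : ∑ s, w s * (1 - x s - n s + k * n s) =
            (∑ s, w s * y s) - M + k * N := by
          rw [hM, hN, Finset.mul_sum, ← Finset.sum_sub_distrib, ← Finset.sum_add_distrib]
          refine Finset.sum_congr rfl fun s _ => ?_
          linear_combination (w s) * hmn s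
        change r 1 ≤ ∑ s, w s * (1 - x s - n s + k * n s)
        rw [e]; linarith
    · simp only [p, mul_left_comm (w _) k, ← Finset.mul_sum]
      exact hk

/-! ### Link rates under a randomized stationary schedule -/

instance : Fintype Action :=
  ⟨{.uncoded 0, .uncoded 1, .reactive, .poison, .remedy}, by
    rintro (j | _ | _ | _)
    · fin_cases j <;> simp
    all_goals simp⟩

theorem sum_action (f : Action → ℝ) : ∑ a, f a =
    f (.uncoded 0) + f (.uncoded 1) + f .reactive + f .poison + f .remedy := by
  have hu : (Finset.univ : Finset Action) =
    {.uncoded 0, .uncoded 1, .reactive, .poison, .remedy} := rfl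
  rw [hu]
  simp [add_assoc]

theorem sum_erasure (f : Erasure → ℝ) : ∑ z, f z =
    f ![true, true] + f ![true, false] + f ![false, true] + f ![false, false] := by
  have hu : (Finset.univ : Finset Erasure) =
    {![true, true], ![true, false], ![false, true], ![false, false]} := by decide
  rw [hu, Finset.sum_insert (by decide), Finset.sum_insert (by decide),
    Finset.sum_insert (by decide), Finset.sum_singleton]
  ring

section Rates

variable {S : Type*} [Fintype S] [DecidableEq S] (ch : Channel S)

theorem Channel.erasureGivenPrev_nonneg (s : S) (z : Erasure) : 0 ≤ ch.erasureGivenPrev s z :=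
  Finset.sum_nonneg fun s' _ => mul_nonneg (ch.stochastic.1 s s') ((ch.W_mem s').1 z)

theorem Channel.sum_erasureGivenPrev (s : S) : ∑ z, ch.erasureGivenPrev s z = 1 := by
  unfold Channel.erasureGivenPrev
  rw [Finset.sum_comm]
  simp_rw [← Finset.mul_sum, (ch.W_mem _).2, mul_one]
  exact Matrix.sum_row_of_mem_rowStochastic ch.stochastic s

/-- Probability that receiver `j` gets the packet, given the previous state `s`. -/
def Channel.receive (j : Fin 2) (s : S) : ℝ :=
  ∑ z, ch.erasureGivenPrev s z * if z j = false then 1 else 0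

/-- Probability that only the receiver other than `j` gets the packet, given the previous
state `s`. -/
def Channel.overhear (j : Fin 2) (s : S) : ℝ :=
  ∑ z, ch.erasureGivenPrev s z * if z j = true ∧ z (other j) = false then 1 else 0

theorem Channel.receive_nonneg (j : Fin 2) (s : S) : 0 ≤ ch.receive j s :=
  Finset.sum_nonneg fun z _ => mul_nonneg (ch.erasureGivenPrev_nonneg s z) (by split_ifs <;> simp)

theorem Channel.overhear_nonneg (j : Fin 2) (s : S) : 0 ≤ ch.overhear j s :=
  Finset.sum_nonneg fun z _ => mul_nonneg (ch.erasureGivenPrev_nonneg s z) (by split_ifs <;> simp)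

theorem Channel.one_sub_eps1 (s : S) : 1 - ch.eps1 s = ch.receive 0 s := by
  have h := ch.sum_erasureGivenPrev s
  rw [sum_erasure] at h
  simp only [Channel.receive, Channel.eps1, Channel.eps12, Channel.eps1not2, sum_erasure]
  simp
  linarith

theorem Channel.one_sub_eps2 (s : S) : 1 - ch.eps2 s = ch.receive 1 s := by
  have h := ch.sum_erasureGivenPrev s
  rw [sum_erasure] at h
  simp only [Channel.receive, Channel.eps2, Channel.eps12, Channel.epsNot12, sum_erasure]
  simp
  linarith

theorem Channel.overhear_add_receive (j : Fin 2) (s : S) :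
    ch.overhear j s + ch.receive j s = 1 - ch.eps12 s := by
  have h := ch.sum_erasureGivenPrev s
  rw [sum_erasure] at h
  simp only [Channel.overhear, Channel.receive, Channel.eps12, sum_erasure]
  fin_cases j <;> simp [other] <;> linarith

theorem Channel.receive_le (j : Fin 2) (s : S) : ch.receive j s ≤ 1 - ch.eps12 s := by
  linarith [ch.overhear_add_receive j s, ch.overhear_nonneg j s]

theorem Channel.one_sub_eps12_nonneg (s : S) : 0 ≤ 1 - ch.eps12 s :=
  (ch.receive_nonneg 0 s).trans (ch.receive_le 0 s)

theorem Channel.receive_le_one (j : Fin 2) (s : S) : ch.receive j s ≤ 1 := by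
  have : 0 ≤ ch.eps12 s := ch.erasureGivenPrev_nonneg s _
  linarith [ch.receive_le j s]

theorem expectedCapacity_nonneg (s : S) (a : Action) (j : Fin 2) (e : Link) :
    0 ≤ expectedCapacity ch s a j e :=
  Finset.sum_nonneg fun z _ => mul_nonneg (ch.erasureGivenPrev_nonneg s z) (Nat.cast_nonneg _)

theorem expectedCapacity_eq (s : S) (a : Action) (j : Fin 2) (e : Link) :
    expectedCapacity ch s a j e = match e with
      | .l12 => if a = .uncoded j then ch.overhear j s else 0
      | .l13 => if a = .poison then 1 - ch.eps12 s else 0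
      | .l14 => if a = .uncoded j then ch.receive j s else 0
      | .l24 => if a = .reactive then ch.receive j s else 0
      | .l32 => if a = .remedy then ch.overhear j s else 0
      | .l34 => if a = .remedy then ch.receive j s else 0 := by
  have h13 : (∑ z, ch.erasureGivenPrev s z * if ¬ (z 0 = true ∧ z 1 = true) then 1 else 0) =
      1 - ch.eps12 s := by
    have h := ch.sum_erasureGivenPrev s
    rw [sum_erasure] at h
    simp only [Channel.eps12, sum_erasure]
    simp
    linarith
  cases e
  case l13 =>
    by_cases ha : a = .poison
    · simpa [expectedCapacity, capacity, ha] using h13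
    · simp [expectedCapacity, capacity, ha]
  all_goals
    simp only [expectedCapacity, capacity, Channel.overhear, Channel.receive]
    split_ifs with ha <;> simp [ha]

/-- Rate of the link `e` in the network of receiver `j` when the previous state is `s` and the
action is chosen with probabilities `p s`. -/
noncomputable def linkRate (p : S → Action → ℝ) (j : Fin 2) (e : Link) (s : S) : ℝ :=
  ∑ a, p s a * expectedCapacity ch s a j e

/-- Steady-state mean of `linkRate`. -/
noncomputable def meanRate (p : S → Action → ℝ) (j : Fin 2) (e : Link) : ℝ :=
  ∑ s, ch.π s * linkRate ch p j e s

theorem linkRate_eq (p : S → Action → ℝ) (j : Fin 2) (e : Link) (s : S) :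
    linkRate ch p j e s = match e with
      | .l12 => p s (.uncoded j) * ch.overhear j s
      | .l13 => p s .poison * (1 - ch.eps12 s)
      | .l14 => p s (.uncoded j) * ch.receive j s
      | .l24 => p s .reactive * ch.receive j s
      | .l32 => p s .remedy * ch.overhear j s
      | .l34 => p s .remedy * ch.receive j s := by
  simp only [linkRate, expectedCapacity_eq]
  cases e <;> simp

theorem meanRate_nonneg {p : S → Action → ℝ} (hp : ∀ s a, 0 ≤ p s a) (j : Fin 2) (e : Link) :
    0 ≤ meanRate ch p j e :=
  Finset.sum_nonneg fun s _ => mul_nonneg (ch.π_mem.1 s)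
    (Finset.sum_nonneg fun a _ => mul_nonneg (hp s a) (expectedCapacity_nonneg ch s a j e))

/-- The cut conditions, for receiver `j`, at a rate `r`: under the action probabilities `p`, every
cut that separates `q1` from the exit is worth at least `r`. -/
structure CutsGe (p : S → Action → ℝ) (j : Fin 2) (r : ℝ) : Prop where
  cut1 : r ≤ meanRate ch p j .l12 + meanRate ch p j .l13 + meanRate ch p j .l14
  cut12 : r ≤ meanRate ch p j .l13 + meanRate ch p j .l14 + meanRate ch p j .l24
  cut13 : r ≤ meanRate ch p j .l12 + meanRate ch p j .l14 + meanRate ch p j .l32 +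
    meanRate ch p j .l34
  cut123 : r ≤ meanRate ch p j .l14 + meanRate ch p j .l24 + meanRate ch p j .l34

/-- The cut conditions follow from three requirements: packets are delivered at the rate `r` if all
buffers are full, packets leave `q1` at the rate `r`, and poisoning and remedying are balanced.
The balance turns the value of the cuts `{q1, q2}` and `{q1, q3}` into that of the other two. -/
theorem cutsGe_of_balanced {p : S → Action → ℝ} (hp : ∀ s a, 0 ≤ p s a) {j : Fin 2} {r : ℝ}
    (hdel : r ≤ ∑ s, ch.π s * ch.receive j s * (p s (.uncoded j) + p s .reactive + p s .remedy))
    (hout : r ≤ ∑ s, ch.π s * (1 - ch.eps12 s) * (p s (.uncoded j) + p s .poison))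
    (hbal : ∑ s, ch.π s * (1 - ch.eps12 s) * p s .poison =
      ∑ s, ch.π s * (1 - ch.eps12 s) * p s .remedy) : CutsGe ch p j r := by
  have hrem : ∑ s, ch.π s * (1 - ch.eps12 s) * p s .remedy =
      meanRate ch p j .l32 + meanRate ch p j .l34 := by
    simp only [meanRate, linkRate_eq, ← Finset.sum_add_distrib]
    refine Finset.sum_congr rfl fun s _ => ?_
    rw [← ch.overhear_add_receive j s]; ring
  have hpoi : ∑ s, ch.π s * (1 - ch.eps12 s) * p s .poison = meanRate ch p j .l13 := by
    simp only [meanRate, linkRate_eq]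
    exact Finset.sum_congr rfl fun s _ => by ring
  have hdel' : ∑ s, ch.π s * ch.receive j s * (p s (.uncoded j) + p s .reactive + p s .remedy) =
      meanRate ch p j .l14 + meanRate ch p j .l24 + meanRate ch p j .l34 := by
    simp only [meanRate, linkRate_eq, ← Finset.sum_add_distrib]
    exact Finset.sum_congr rfl fun s _ => by ring
  have hout' : ∑ s, ch.π s * (1 - ch.eps12 s) * (p s (.uncoded j) + p s .poison) =
      meanRate ch p j .l12 + meanRate ch p j .l13 + meanRate ch p j .l14 := by
    simp only [meanRate, linkRate_eq, ← Finset.sum_add_distrib]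
    refine Finset.sum_congr rfl fun s _ => ?_
    rw [← ch.overhear_add_receive j s]; ring
  have h32 := meanRate_nonneg ch hp j .l32
  constructor <;> linarith

/-- Every pair of rates that stays in the region when increased by `δ` is supported, with a margin,
by a randomized choice of the action that depends on the previous channel state only. The margin
at the buffers `q2` and `q3` comes from a small probability of the actions that empty them. -/
theorem exists_schedule {R : Fin 2 → ℝ} (hR0 : ∀ j, 0 ≤ R j) {δ : ℝ} (hδ : 0 < δ)
    (hR : (R 0 + δ, R 1 + δ) ∈ ch.region) :
    ∃ p : S → Action → ℝ, (∀ s a, 0 ≤ p s a) ∧ (∀ s, ∑ a, p s a = 1) ∧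
      ∃ ε, 0 < ε ∧ ∀ j, CutsGe ch p j (R j + ε) ∧
        ε ≤ meanRate ch p j .l24 ∧ ε ≤ meanRate ch p j .l34 := by
  -- A point `r` of the set whose closure is the region, with `R j + δ / 2 < r j`.
  obtain ⟨⟨r0, r1⟩, ⟨-, -, x, y, hx, hy, h0x, h0y, h1y, h1x⟩, hdist⟩ :=
    Metric.mem_closure_iff.1 hR (δ / 2) (half_pos hδ)
  rw [Prod.dist_eq, max_lt_iff, Real.dist_eq, Real.dist_eq, abs_lt, abs_lt] at hdist
  simp only at h0x h0y h1y h1x hdist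
  obtain ⟨⟨-, hr0⟩, -, hr1⟩ := hdist
  set r : Fin 2 → ℝ := ![r0, r1] with hr
  have hrR : ∀ j, R j + δ / 2 < r j := by
    intro j
    fin_cases j
    · change R 0 + δ / 2 < r0; linarith
    · change R 1 + δ / 2 < r1; linarith
  have hw : ∀ s, 0 ≤ ch.π s * (1 - ch.eps12 s) := fun s =>
    mul_nonneg (ch.π_mem.1 s) (ch.one_sub_eps12_nonneg s)
  have hπd : ∀ j s, 0 ≤ ch.π s * ch.receive j s := fun j s =>
    mul_nonneg (ch.π_mem.1 s) (ch.receive_nonneg j s)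
  obtain ⟨p, hp0, hp1, hpx, hpy, hpo, hpb⟩ := exists_balanced_schedule (r := r) hw hx hy h0y
    (h1y.trans (Finset.sum_le_sum fun s _ => by
      rw [ch.one_sub_eps2]
      exact mul_le_mul_of_nonneg_right
        (mul_le_mul_of_nonneg_left (ch.receive_le 1 s) (ch.π_mem.1 s)) (hy s).1)) h1x
  have hdel : ∀ j, r j ≤
      ∑ s, ch.π s * ch.receive j s * (p s (.uncoded j) + p s .reactive + p s .remedy) := by
    intro j
    fin_cases j
    · refine h0x.trans (Finset.sum_le_sum fun s _ => ?_)
      rw [ch.one_sub_eps1]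
      exact mul_le_mul_of_nonneg_left (hpx s) (hπd 0 s)
    · refine h1y.trans (Finset.sum_le_sum fun s _ => ?_)
      rw [ch.one_sub_eps2]
      exact mul_le_mul_of_nonneg_left (hpy s) (hπd 1 s)
  have hcut : ∀ j, CutsGe ch p j (r j) := fun j =>
    cutsGe_of_balanced ch hp0 (hdel j) (hpo j) hpb
  have hrec : ∀ j, r j ≤ ∑ s, ch.π s * ch.receive j s := fun j =>
    (hdel j).trans (Finset.sum_le_sum fun s _ => mul_le_of_le_one_right (hπd j s) (by
      have h := hp1 s
      have h0 := hp0 s (.uncoded 0)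
      have h1 := hp0 s (.uncoded 1)
      have h4 := hp0 s .poison
      fin_cases j
      · change p s (.uncoded 0) + _ + _ ≤ 1; linarith
      · change p s (.uncoded 1) + _ + _ ≤ 1; linarith))
  have hr_le : ∀ j, r j ≤ 1 := fun j => (hrec j).trans (by
    rw [← ch.π_mem.2]
    exact Finset.sum_le_sum fun s _ => mul_le_of_le_one_right (ch.π_mem.1 s) (ch.receive_le_one j s))
  -- Since `r j ≤ 1`, giving up a fraction `2 * η ≤ δ / 4` of the time leaves
  -- `δ / 4` of the surplus `δ / 2`.
  set η : ℝ := min (1 / 4) (δ / 8) with hη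
  have hη0 : 0 < η := by positivity
  have hη4 : η ≤ 1 / 4 := min_le_left _ _
  have hη8 : η ≤ δ / 8 := min_le_right _ _
  let extra : Action → ℝ := fun a => if a = .reactive ∨ a = .remedy then η else 0
  have hextra : ∀ a, 0 ≤ extra a := fun a => by
    simp only [extra]; split_ifs <;> [exact hη0.le; exact le_rfl]
  let p' : S → Action → ℝ := fun s a => (1 - 2 * η) * p s a + extra a
  have hp'0 : ∀ s a, 0 ≤ p' s a := fun s a =>
    add_nonneg (mul_nonneg (by linarith) (hp0 s a)) (hextra a)
  have hmean : ∀ j e, meanRate ch p' j e =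
      (1 - 2 * η) * meanRate ch p j e + meanRate ch (fun _ => extra) j e := by
    intro j e
    simp only [meanRate, linkRate, p', add_mul, Finset.sum_add_distrib, mul_add, mul_assoc,
      ← Finset.mul_sum, mul_left_comm (ch.π _) (1 - 2 * η)]
  have hmean_ge : ∀ j e, (1 - 2 * η) * meanRate ch p j e ≤ meanRate ch p' j e := fun j e => by
    have := meanRate_nonneg ch (p := fun _ => extra) (fun _ => hextra) j e
    rw [hmean]; linarith
  have hextra24 : ∀ j, meanRate ch (fun _ => extra) j .l24 = η * ∑ s, ch.π s * ch.receive j s := by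
    intro j
    simp only [meanRate, linkRate_eq, extra, Finset.mul_sum]
    exact Finset.sum_congr rfl fun s _ => by simp; ring
  have hextra34 : ∀ j, meanRate ch (fun _ => extra) j .l34 = η * ∑ s, ch.π s * ch.receive j s := by
    intro j
    simp only [meanRate, linkRate_eq, extra, Finset.mul_sum]
    exact Finset.sum_congr rfl fun s _ => by simp; ring
  have hserve : ∀ j, η * (δ / 2) ≤ η * ∑ s, ch.π s * ch.receive j s := fun j =>
    mul_le_mul_of_nonneg_left (by linarith [hrec j, hrR j, hR0 j]) hη0.le
  have hε : min (δ / 4) (η * (δ / 2)) ≤ δ / 4 := min_le_left _ _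
  have hε' : min (δ / 4) (η * (δ / 2)) ≤ η * (δ / 2) := min_le_right _ _
  refine ⟨p', hp'0, fun s => ?_, min (δ / 4) (η * (δ / 2)), by positivity, fun j => ⟨?_, ?_, ?_⟩⟩
  · simp only [sum_action, p', extra]
    have h := hp1 s
    simp
    linear_combination (1 - 2 * η) * h
  · have hmargin : R j + min (δ / 4) (η * (δ / 2)) ≤ (1 - 2 * η) * r j := by
      nlinarith [hrR j, hr_le j, hR0 j]
    have hscale : ∀ {c : ℝ}, r j ≤ c → R j + min (δ / 4) (η * (δ / 2)) ≤ (1 - 2 * η) * c :=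
      fun h => hmargin.trans (mul_le_mul_of_nonneg_left h (by linarith))
    have e12 := hmean_ge j .l12
    have e13 := hmean_ge j .l13
    have e14 := hmean_ge j .l14
    have e24 := hmean_ge j .l24
    have e32 := hmean_ge j .l32
    have e34 := hmean_ge j .l34
    constructor
    · linarith [hscale (hcut j).cut1]
    · linarith [hscale (hcut j).cut12]
    · linarith [hscale (hcut j).cut13]
    · linarith [hscale (hcut j).cut123]
  · have h0 := mul_nonneg (a := 1 - 2 * η) (by linarith) (meanRate_nonneg ch hp0 j .l24)
    rw [hmean, hextra24]
    linarith [hserve j]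
  · have h0 := mul_nonneg (a := 1 - 2 * η) (by linarith) (meanRate_nonneg ch hp0 j .l34)
    rw [hmean, hextra34]
    linarith [hserve j]

end Rates

/-! ### Expectations over one slot -/

/-- What enters the system during a slot: the new channel state, the erasure pattern and the
arrivals. -/
abbrev Input (S : Type*) := S × Erasure × (Fin 2 → Bool)

section Slot

variable {S : Type*} [Fintype S] [DecidableEq S] (ch : Channel S) (R : Fin 2 → ℝ)

/-- Conditional probability of the input of a slot given the previous channel state. -/
noncomputable def inputProb (s : S) (y : Input S) : ℝ :=
  ch.P s y.1 * ch.W y.1 y.2.1 * ∏ j : Fin 2, (if y.2.2 j = true then R j else 1 - R j)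

/-- Conditional mean of a function of the input of a slot given the previous channel state. -/
noncomputable def slotMean (s : S) (f : Input S → ℝ) : ℝ := ∑ y, inputProb ch R s y * f y

variable {R} in
theorem inputProb_nonneg (hR : ∀ j, 0 ≤ R j ∧ R j ≤ 1) (s : S) (y : Input S) :
    0 ≤ inputProb ch R s y := by
  refine mul_nonneg (mul_nonneg (ch.stochastic.1 s _) ((ch.W_mem _).1 _))
    (Finset.prod_nonneg fun j _ => ?_)
  split_ifs
  · exact (hR j).1
  · exact sub_nonneg.2 (hR j).2

variable {R} in
theorem slotMean_mono (hR : ∀ j, 0 ≤ R j ∧ R j ≤ 1) (s : S) {f g : Input S → ℝ}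
    (h : ∀ y, f y ≤ g y) : slotMean ch R s f ≤ slotMean ch R s g :=
  Finset.sum_le_sum fun y _ => mul_le_mul_of_nonneg_left (h y) (inputProb_nonneg ch hR s y)

theorem slotMean_add (s : S) (f g : Input S → ℝ) :
    slotMean ch R s (fun y => f y + g y) = slotMean ch R s f + slotMean ch R s g := by
  simp only [slotMean, mul_add, Finset.sum_add_distrib]

theorem slotMean_sub (s : S) (f g : Input S → ℝ) :
    slotMean ch R s (fun y => f y - g y) = slotMean ch R s f - slotMean ch R s g := by
  simp only [slotMean, mul_sub, Finset.sum_sub_distrib]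

theorem slotMean_const_mul (s : S) (k : ℝ) (f : Input S → ℝ) :
    slotMean ch R s (fun y => k * f y) = k * slotMean ch R s f := by
  simp only [slotMean, mul_left_comm _ k, Finset.mul_sum]

theorem slotMean_sum {ι : Type*} (t : Finset ι) (s : S) (f : ι → Input S → ℝ) :
    slotMean ch R s (fun y => ∑ i ∈ t, f i y) = ∑ i ∈ t, slotMean ch R s (f i) := by
  simp only [slotMean, Finset.mul_sum]
  exact Finset.sum_comm

theorem sum_prod_bernoulli :
    ∑ b : Fin 2 → Bool, ∏ j : Fin 2, (if b j = true then R j else 1 - R j) = 1 := by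
  rw [sum_erasure]
  simp [Fin.prod_univ_two]
  ring

theorem slotMean_state (s : S) (f : S → ℝ) :
    slotMean ch R s (fun y => f y.1) = ∑ s', ch.P s s' * f s' := by
  simp only [slotMean, inputProb, Fintype.sum_prod_type, mul_right_comm _ _ (f _),
    ← Finset.mul_sum, sum_prod_bernoulli, mul_one]
  exact Finset.sum_congr rfl fun s' _ => by rw [(ch.W_mem s').2, mul_one]

theorem slotMean_const (s : S) (k : ℝ) : slotMean ch R s (fun _ => k) = k := by
  rw [slotMean_state ch R s fun _ => k, ← Finset.sum_mul,
    Matrix.sum_row_of_mem_rowStochastic ch.stochastic, one_mul]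

theorem slotMean_erasure (s : S) (f : Erasure → ℝ) :
    slotMean ch R s (fun y => f y.2.1) = ∑ z, ch.erasureGivenPrev s z * f z := by
  simp only [slotMean, inputProb, Fintype.sum_prod_type, mul_right_comm _ _ (f _),
    ← Finset.mul_sum, sum_prod_bernoulli, mul_one, Channel.erasureGivenPrev, Finset.sum_mul]
  exact Finset.sum_comm

theorem slotMean_arrival (s : S) (j : Fin 2) :
    slotMean ch R s (fun y => if y.2.2 j = true then 1 else 0) = R j := by
  have hb : ∑ b : Fin 2 → Bool, (∏ i : Fin 2, (if b i = true then R i else 1 - R i)) *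
      (if b j = true then 1 else 0) = R j := by
    rw [sum_erasure]
    fin_cases j <;> simp [Fin.prod_univ_two] <;> ring
  have h1 := slotMean_const ch R s (R j)
  simp only [slotMean, inputProb, Fintype.sum_prod_type, mul_assoc, ← Finset.mul_sum, hb] at h1 ⊢
  refine Eq.trans ?_ h1
  simp only [← Finset.sum_mul, sum_prod_bernoulli, one_mul]

end Slot

/-! ### Quadratic drift -/

/-- Positive part of the differential backlog of a link. -/
noncomputable def pressure (q : QueueState) (j : Fin 2) (e : Link) : ℝ :=
  max ((q j e.src : ℝ) - (backlog q j e.dst : ℝ)) 0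

theorem pressure_nonneg (q : QueueState) (j : Fin 2) (e : Link) : 0 ≤ pressure q j e :=
  le_max_right _ _

theorem flow_le_one (q : QueueState) (a : Action) (z : Erasure) (j : Fin 2) (e : Link) :
    flow q a z j e ≤ 1 := by
  have h : capacity a z j e ≤ 1 := by
    cases e <;> simp only [capacity] <;> split_ifs <;> simp
  unfold flow service activation
  split_ifs <;> simp [h]

theorem outflow_le_six (q : QueueState) (a : Action) (z : Erasure) (j : Fin 2) (l : Buffer) :
    outflow q a z j l ≤ 6 := by
  refine (Finset.sum_le_card_nsmul Finset.univ _ 1 fun e _ => ?_).trans (le_refl 6)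
  split_ifs
  · exact flow_le_one q a z j e
  · exact zero_le_one

theorem inflow_le_six (q : QueueState) (a : Action) (z : Erasure) (j : Fin 2) (l : Buffer) :
    inflow q a z j l ≤ 6 := by
  refine (Finset.sum_le_card_nsmul Finset.univ _ 1 fun e _ => ?_).trans (le_refl 6)
  split_ifs
  · exact flow_le_one q a z j e
  · exact zero_le_one

theorem arrival_le_one (b : Fin 2 → Bool) (j : Fin 2) (l : Buffer) : arrival b j l ≤ 1 := by
  unfold arrival; split_ifs <;> simp

theorem cast_nextQueue (q : QueueState) (a : Action) (z : Erasure) (b : Fin 2 → Bool)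
    (j : Fin 2) (l : Buffer) : (nextQueue q a z b j l : ℝ) =
      q j l + (inflow q a z j l - outflow q a z j l + arrival b j l) := by
  simp only [nextQueue, Nat.cast_add, Nat.cast_sub (outflow_le q a z j l)]
  ring

theorem abs_nextQueue_sub_le (q : QueueState) (a : Action) (z : Erasure) (b : Fin 2 → Bool)
    (j : Fin 2) (l : Buffer) : |(nextQueue q a z b j l : ℝ) - q j l| ≤ 7 := by
  have h1 : (outflow q a z j l : ℝ) ≤ 6 := by exact_mod_cast outflow_le_six q a z j l
  have h2 : (inflow q a z j l : ℝ) ≤ 6 := by exact_mod_cast inflow_le_six q a z j l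
  have h3 : (arrival b j l : ℝ) ≤ 1 := by exact_mod_cast arrival_le_one b j l
  have h4 : (0 : ℝ) ≤ outflow q a z j l := Nat.cast_nonneg _
  have h5 : (0 : ℝ) ≤ inflow q a z j l := Nat.cast_nonneg _
  have h6 : (0 : ℝ) ≤ arrival b j l := Nat.cast_nonneg _
  rw [cast_nextQueue, abs_le]
  constructor <;> linarith

theorem pressure_nextQueue_le (q : QueueState) (a : Action) (z : Erasure) (b : Fin 2 → Bool)
    (j : Fin 2) (e : Link) : pressure (nextQueue q a z b) j e ≤ pressure q j e + 14 := by
  have hs := abs_le.1 (abs_nextQueue_sub_le q a z b j e.src)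
  have hd : (backlog q j e.dst : ℝ) - 7 ≤ backlog (nextQueue q a z b) j e.dst := by
    cases hm : e.dst with
    | none => simp [backlog]
    | some l =>
      have := abs_le.1 (abs_nextQueue_sub_le q a z b j l)
      simp only [backlog]
      linarith
  have := le_max_left ((q j e.src : ℝ) - (backlog q j e.dst : ℝ)) 0
  have := le_max_right ((q j e.src : ℝ) - (backlog q j e.dst : ℝ)) 0
  unfold pressure
  exact max_le (by linarith) (by linarith)

theorem sum_mul_outflow (q : QueueState) (a : Action) (z : Erasure) (j : Fin 2) :
    ∑ l, (q j l : ℝ) * outflow q a z j l = ∑ e : Link, (q j e.src : ℝ) * flow q a z j e := by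
  simp only [outflow, Nat.cast_sum, Finset.mul_sum, Nat.cast_ite, Nat.cast_zero, mul_ite, mul_zero]
  rw [Finset.sum_comm]
  simp

theorem sum_mul_inflow (q : QueueState) (a : Action) (z : Erasure) (j : Fin 2) :
    ∑ l, (q j l : ℝ) * inflow q a z j l =
      ∑ e : Link, (backlog q j e.dst : ℝ) * flow q a z j e := by
  simp only [inflow, Nat.cast_sum, Finset.mul_sum, Nat.cast_ite, Nat.cast_zero, mul_ite, mul_zero]
  rw [Finset.sum_comm]
  refine Finset.sum_congr rfl fun e _ => ?_
  cases hm : e.dst <;> simp [backlog]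

/-- A link is used only if its differential backlog is positive, so its contribution to the drift
is the one that enters the weight of the action. -/
theorem diff_mul_flow (q : QueueState) (a : Action) (z : Erasure) (j : Fin 2) (e : Link) :
    ((q j e.src : ℝ) - backlog q j e.dst) * flow q a z j e =
      pressure q j e * capacity a z j e := by
  by_cases h : backlog q j e.dst < q j e.src
  · have h' : (backlog q j e.dst : ℝ) < q j e.src := by exact_mod_cast h
    rw [pressure, max_eq_left (by linarith)]
    simp [flow, service, activation, h, (Nat.zero_le _).trans_lt h]
  · have h' : (q j e.src : ℝ) ≤ backlog q j e.dst := by exact_mod_cast not_lt.1 h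
    rw [pressure, max_eq_right (by linarith)]
    simp [flow, service, activation, h]

/-- Sum of the squared backlogs. -/
noncomputable def sumSq (q : QueueState) : ℝ := ∑ j, ∑ l, (q j l : ℝ) ^ 2

/-- The constant is `6 * 7 ^ 2`: each of the six backlogs changes by at most `7` in a slot, by the
crude bounds on its inflow, outflow and arrivals. -/
theorem sumSq_nextQueue_le (q : QueueState) (a : Action) (z : Erasure) (b : Fin 2 → Bool) :
    sumSq (nextQueue q a z b) ≤ sumSq q + 294 +
      2 * (∑ j, (q j .q1 : ℝ) * (if b j = true then 1 else 0) -
        ∑ j, ∑ e, pressure q j e * capacity a z j e) := by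
  have hstep : ∀ j l, (nextQueue q a z b j l : ℝ) ^ 2 ≤ (q j l : ℝ) ^ 2 + 49 +
      2 * ((q j l : ℝ) * inflow q a z j l - (q j l : ℝ) * outflow q a z j l +
        (q j l : ℝ) * arrival b j l) := by
    intro j l
    have h := abs_le.1 (abs_nextQueue_sub_le q a z b j l)
    rw [cast_nextQueue] at h ⊢
    nlinarith
  have hcard : (Finset.univ : Finset Buffer).card = 3 := rfl
  have harr : ∀ j, ∑ l, (q j l : ℝ) * arrival b j l =
      (q j .q1 : ℝ) * (if b j = true then 1 else 0) := by
    intro j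
    rw [Finset.sum_eq_single Buffer.q1 (fun l _ hl => by simp [arrival, hl]) (by simp)]
    simp [arrival]
  refine (Finset.sum_le_sum fun j _ => Finset.sum_le_sum fun l _ => hstep j l).trans_eq ?_
  simp only [← diff_mul_flow, sub_mul, Finset.sum_add_distrib, Finset.sum_sub_distrib,
    ← Finset.mul_sum, sum_mul_outflow, sum_mul_inflow, harr, sumSq, Finset.sum_const, hcard,
    Finset.card_univ, Fintype.card_fin]
  norm_num
  ring

section Lyapunov

variable {S : Type*} [Fintype S] [DecidableEq S] (ch : Channel S)

/-- The arrivals do not matter here, so any arrival rates `R` may be taken. -/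
theorem weight_eq_slotMean (R : Fin 2 → ℝ) (q : QueueState) (s : S) (a : Action) :
    weight ch q s a = slotMean ch R s
      (fun y => ∑ j, ∑ e, pressure q j e * capacity a y.2.1 j e) := by
  rw [slotMean_erasure ch R s fun z => ∑ j, ∑ e, pressure q j e * capacity a z j e]
  simp only [weight, expectedCapacity, Finset.mul_sum]
  rw [Finset.sum_comm]
  simp_rw [Finset.sum_comm (s := (Finset.univ : Finset Erasure))]
  rw [Finset.sum_comm]
  refine Finset.sum_congr rfl fun j _ => Finset.sum_congr rfl fun e _ =>
    Finset.sum_congr rfl fun z _ => ?_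
  rw [pressure]; ring

/-- A max-weight action does at least as well as any random choice of the action. -/
theorem sum_pressure_mul_linkRate_le {act : QueueState → S → Action} (hact : IsMaxWeight ch act)
    {p : S → Action → ℝ} (hp0 : ∀ s a, 0 ≤ p s a) (hp1 : ∀ s, ∑ a, p s a = 1)
    (q : QueueState) (s : S) :
    ∑ j, ∑ e, pressure q j e * linkRate ch p j e s ≤ weight ch q s (act q s) := by
  have e1 : ∑ j, ∑ e, pressure q j e * linkRate ch p j e s = ∑ a, p s a * weight ch q s a := by
    simp only [linkRate, weight, Finset.mul_sum]
    simp_rw [Finset.sum_comm (s := (Finset.univ : Finset Action))]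
    refine Finset.sum_congr rfl fun j _ => Finset.sum_congr rfl fun e _ =>
      Finset.sum_congr rfl fun a _ => ?_
    rw [pressure]; ring
  rw [e1]
  calc ∑ a, p s a * weight ch q s a ≤ ∑ a, p s a * weight ch q s (act q s) :=
        Finset.sum_le_sum fun a _ => mul_le_mul_of_nonneg_left (hact q s a) (hp0 s a)
    _ = weight ch q s (act q s) := by rw [← Finset.sum_mul, hp1, one_mul]

/-- The Lyapunov function: the quadratic one, corrected by a term that grows linearly with the
backlogs and depends on the previous channel state through `h`. -/
noncomputable def lyapunov (h : Fin 2 → Link → S → ℝ) (q : QueueState) (s : S) : ℝ :=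
  sumSq q + 2 * ∑ j, ∑ e, pressure q j e * h j e s

/-- When `h` solves Poisson's equation for the link rates of a randomized schedule, the corrector
replaces these rates in the drift by their steady-state means, up to a bounded error. -/
theorem slotMean_lyapunov_le {R : Fin 2 → ℝ} (hR : ∀ j, 0 ≤ R j ∧ R j ≤ 1)
    {act : QueueState → S → Action} (hact : IsMaxWeight ch act)
    {p : S → Action → ℝ} (hp0 : ∀ s a, 0 ≤ p s a) (hp1 : ∀ s, ∑ a, p s a = 1)
    {h : Fin 2 → Link → S → ℝ} (h0 : ∀ j e s, 0 ≤ h j e s)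
    (hh : ∀ j e s, ∑ s', ch.P s s' * h j e s' - h j e s =
      linkRate ch p j e s - meanRate ch p j e) (q : QueueState) (s : S) :
    slotMean ch R s (fun y => lyapunov h (nextQueue q (act q s) y.2.1 y.2.2) y.1) ≤
      lyapunov h q s + (294 + 28 * ∑ j, ∑ e, ∑ s', ch.P s s' * h j e s') +
        2 * (∑ j, (R j * q j .q1 - ∑ e, pressure q j e * meanRate ch p j e)) := by
  have hpath : ∀ y : Input S, lyapunov h (nextQueue q (act q s) y.2.1 y.2.2) y.1 ≤
      sumSq q + 294 + 2 * (∑ j, (q j .q1 : ℝ) * (if y.2.2 j = true then 1 else 0) -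
        ∑ j, ∑ e, pressure q j e * capacity (act q s) y.2.1 j e) +
      2 * ∑ j, ∑ e, (pressure q j e + 14) * h j e y.1 := by
    intro y
    refine add_le_add (sumSq_nextQueue_le _ _ _ _) (mul_le_mul_of_nonneg_left
      (Finset.sum_le_sum fun j _ => Finset.sum_le_sum fun e _ => ?_) zero_le_two)
    exact mul_le_mul_of_nonneg_right (pressure_nextQueue_le _ _ _ _ _ _) (h0 j e _)
  refine (slotMean_mono ch hR s hpath).trans ?_
  have hmeans : ∀ j e, (pressure q j e + 14) * ∑ s', ch.P s s' * h j e s' =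
      pressure q j e * h j e s + pressure q j e * linkRate ch p j e s -
        pressure q j e * meanRate ch p j e + 14 * ∑ s', ch.P s s' * h j e s' := by
    intro j e
    linear_combination pressure q j e * hh j e s
  rw [slotMean_add, slotMean_add, slotMean_const, slotMean_const_mul, slotMean_const_mul,
    slotMean_sub, ← weight_eq_slotMean, slotMean_sum, slotMean_sum]
  simp_rw [slotMean_sum, slotMean_const_mul, slotMean_arrival, slotMean_state, hmeans]
  have hw := sum_pressure_mul_linkRate_le ch hact hp0 hp1 q s
  simp only [Finset.sum_add_distrib, Finset.sum_sub_distrib, ← Finset.mul_sum, lyapunov,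
    mul_comm (R _)] at *
  linarith

/-- Under a max-weight policy the queues, together with the previous channel state, have a
nonnegative Lyapunov function of at most quadratic growth whose mean drift is at most a constant
minus a positive multiple of the total backlog. -/
theorem exists_lyapunov {R : Fin 2 → ℝ} (hR : ∀ j, 0 ≤ R j ∧ R j ≤ 1) {δ : ℝ} (hδ : 0 < δ)
    (hreg : (R 0 + δ, R 1 + δ) ∈ ch.region)
    {act : QueueState → S → Action} (hact : IsMaxWeight ch act) :
    ∃ (U : QueueState → S → ℝ) (ε K C : ℝ), 0 < ε ∧ 0 ≤ K ∧ 0 ≤ C ∧ (∀ q s, 0 ≤ U q s) ∧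
      (∀ q s, U q s ≤ C * sumSq q) ∧
      ∀ q s, slotMean ch R s (fun y => U (nextQueue q (act q s) y.2.1 y.2.2) y.1) +
        ε * ∑ j, ∑ l, (q j l : ℝ) ≤ U q s + K := by
  obtain ⟨p, hp0, hp1, ε, hε, hp⟩ := exists_schedule ch (fun j => (hR j).1) hδ hreg
  choose h h0 hh using fun j e => ch.exists_poisson (linkRate ch p j e)
  have hPh : ∀ j e s, 0 ≤ ∑ s', ch.P s s' * h j e s' := fun j e s =>
    Finset.sum_nonneg fun s' _ => mul_nonneg (ch.stochastic.1 s s') (h0 j e s')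
  have hsq0 : ∀ q, 0 ≤ sumSq q := fun q =>
    Finset.sum_nonneg fun j _ => Finset.sum_nonneg fun l _ => sq_nonneg _
  have hH : ∀ s, ∑ j, ∑ e, h j e s ≤ ∑ s, ∑ j, ∑ e, h j e s := fun s =>
    Finset.single_le_sum (f := fun s => ∑ j, ∑ e, h j e s)
      (fun s _ => Finset.sum_nonneg fun j _ => Finset.sum_nonneg fun e _ => h0 j e s)
      (Finset.mem_univ s)
  have hK : ∀ s, ∑ j, ∑ e, ∑ s', ch.P s s' * h j e s' ≤
      ∑ s, ∑ j, ∑ e, ∑ s', ch.P s s' * h j e s' := fun s =>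
    Finset.single_le_sum (f := fun s => ∑ j, ∑ e, ∑ s', ch.P s s' * h j e s')
      (fun s _ => Finset.sum_nonneg fun j _ => Finset.sum_nonneg fun e _ => hPh j e s)
      (Finset.mem_univ s)
  refine ⟨lyapunov h, 2 * (ε / 3), 294 + 28 * ∑ s, ∑ j, ∑ e, ∑ s', ch.P s s' * h j e s',
    1 + 2 * ∑ s, ∑ j, ∑ e, h j e s, by positivity, ?_, ?_, ?_, ?_, ?_⟩
  · have : 0 ≤ ∑ s, ∑ j, ∑ e, ∑ s', ch.P s s' * h j e s' := Finset.sum_nonneg fun s _ =>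
      Finset.sum_nonneg fun j _ => Finset.sum_nonneg fun e _ => hPh j e s
    linarith
  · have : 0 ≤ ∑ s, ∑ j, ∑ e, h j e s := Finset.sum_nonneg fun s _ =>
      Finset.sum_nonneg fun j _ => Finset.sum_nonneg fun e _ => h0 j e s
    linarith
  · intro q s
    exact add_nonneg (hsq0 q) (mul_nonneg zero_le_two (Finset.sum_nonneg fun j _ =>
      Finset.sum_nonneg fun e _ => mul_nonneg (pressure_nonneg q j e) (h0 j e s)))
  · intro q s
    have hpr : ∀ j e, pressure q j e ≤ sumSq q := by
      intro j e
      have hb : (0 : ℝ) ≤ backlog q j e.dst := Nat.cast_nonneg _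
      have h1 : (q j e.src : ℝ) ≤ (q j e.src : ℝ) ^ 2 := by
        exact_mod_cast Nat.le_self_pow two_ne_zero _
      have h2 : (q j e.src : ℝ) ^ 2 ≤ ∑ l, (q j l : ℝ) ^ 2 :=
        Finset.single_le_sum (f := fun l => (q j l : ℝ) ^ 2) (fun l _ => sq_nonneg _)
          (Finset.mem_univ _)
      have h3 : ∑ l, (q j l : ℝ) ^ 2 ≤ sumSq q :=
        Finset.single_le_sum (f := fun j => ∑ l, (q j l : ℝ) ^ 2)
          (fun j _ => Finset.sum_nonneg fun l _ => sq_nonneg _) (Finset.mem_univ j)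
      exact max_le (by linarith) (hsq0 q)
    have h4 : ∑ j, ∑ e, pressure q j e * h j e s ≤ sumSq q * ∑ j, ∑ e, h j e s := by
      simp only [Finset.mul_sum]
      exact Finset.sum_le_sum fun j _ => Finset.sum_le_sum fun e _ =>
        mul_le_mul_of_nonneg_right (hpr j e) (h0 j e s)
    have h5 := mul_le_mul_of_nonneg_left (hH s) (hsq0 q)
    unfold lyapunov
    linarith
  · intro q s
    have hd := slotMean_lyapunov_le ch hR hact hp0 hp1 h0 hh q s
    have hc : ∑ j, (R j * q j .q1 - ∑ e, pressure q j e * meanRate ch p j e) ≤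
        ∑ j, -(ε / 3 * ∑ l, (q j l : ℝ)) := by
      refine Finset.sum_le_sum fun j _ => ?_
      obtain ⟨hcut, h24, h34⟩ := hp j
      have := le_sum_mul_posPart_of_cuts (meanRate_nonneg ch hp0 j) hε.le hcut.cut1 hcut.cut12
        hcut.cut13 hcut.cut123 h24 h34 q j
      simp only [pressure]
      linarith
    rw [Finset.sum_neg_distrib, ← Finset.mul_sum] at hc
    linarith [hK s]

end Lyapunov

/-! ### Random variables with countably many values -/

section Countable

variable {Ω : Type*} [MeasurableSpace Ω] {μ : Measure Ω} {α : Type*} [Countable α]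

theorem measurable_comp_of_fibers {β : Type*} [MeasurableSpace β] {X : Ω → α}
    (hX : ∀ x, MeasurableSet {ω | X ω = x}) (f : α → β) : Measurable fun ω => f (X ω) := by
  let _ : MeasurableSpace α := ⊤
  have hXm : Measurable X := measurable_to_countable' fun x => hX x
  exact measurable_from_top.comp hXm

theorem lintegral_comp_eq_tsum {X : Ω → α} (hX : ∀ x, MeasurableSet {ω | X ω = x})
    (f : α → ℝ≥0∞) : ∫⁻ ω, f (X ω) ∂μ = ∑' x, f x * μ {ω | X ω = x} := by
  let _ : MeasurableSpace α := ⊤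
  have hXm : Measurable X := measurable_to_countable' fun x => hX x
  have hmap : ∀ x, μ.map X {x} = μ {ω | X ω = x} := fun x =>
    Measure.map_apply hXm (MeasurableSet.singleton x)
  rw [← lintegral_map (f := f) measurable_from_top hXm, lintegral_countable']
  simp_rw [hmap]

/-- If `k x` is the conditional law of `Y` given `X = x`, then a mean over `(X, Y)` can be computed
by averaging over `Y` first. -/
theorem lintegral_eq_lintegral_sum_of_condLaw {β : Type*} [Fintype β] {X : Ω → α} {Y : Ω → β}
    (hX : ∀ x, MeasurableSet {ω | X ω = x}) (hY : ∀ y, MeasurableSet {ω | Y ω = y})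
    {k : α → β → ℝ≥0∞} (hk : ∀ x y, μ {ω | X ω = x ∧ Y ω = y} = μ {ω | X ω = x} * k x y)
    (g : α → β → ℝ≥0∞) :
    ∫⁻ ω, g (X ω) (Y ω) ∂μ = ∫⁻ ω, ∑ y, k (X ω) y * g (X ω) y ∂μ := by
  have hXY : ∀ p : α × β, MeasurableSet {ω | (X ω, Y ω) = p} := by
    rintro ⟨x, y⟩
    simp only [Prod.mk.injEq]
    exact (hX x).inter (hY y)
  rw [lintegral_comp_eq_tsum hXY fun p => g p.1 p.2,
    lintegral_comp_eq_tsum hX fun x => ∑ y, k x y * g x y, ENNReal.tsum_prod']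
  refine tsum_congr fun x => ?_
  rw [tsum_fintype, Finset.sum_mul]
  refine Finset.sum_congr rfl fun y _ => ?_
  simp only [Prod.mk.injEq, hk]
  ring

end Countable

/-! ### The Markov property of the queues -/

/-- The queue state in slot `n + 1` is a function of the initial queue state, the channel states
before that slot, and the erasures and arrivals of the first `n` slots. -/
theorem queue_congr {S : Type*} (act : QueueState → S → Action) (q : QueueState)
    {s s' : ℕ → S} {z z' : ℕ → Erasure} {b b' : ℕ → Fin 2 → Bool} (n : ℕ)
    (hs0 : s 0 = s' 0)
    (h : ∀ t < n, s (t + 1) = s' (t + 1) ∧ z (t + 1) = z' (t + 1) ∧ b (t + 1) = b' (t + 1)) :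
    queue act q s z b (n + 1) = queue act q s' z' b' (n + 1) := by
  induction n with
  | zero => rfl
  | succ n ih =>
    have hn : s n = s' n := by
      cases n with
      | zero => exact hs0
      | succ m => exact (h m (by omega)).1
    have hlast := h n (Nat.lt_succ_self n)
    simp only [queue, ih fun t ht => h t (by omega), hn, hlast.2.1, hlast.2.2]

/-- The input of slot `t`. -/
def input {S Ω : Type*} (St : ℕ → Ω → S) (Z : ℕ → Ω → Erasure) (B : ℕ → Ω → Fin 2 → Bool)
    (t : ℕ) (ω : Ω) : Input S := (St t ω, Z t ω, B t ω)

/-- Everything that has been decided when slot `n + 1` begins: the initial queue and channel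
states and the inputs of the first `n` slots. -/
def history {S Ω : Type*} (Q₁ : Ω → QueueState) (St : ℕ → Ω → S) (Z : ℕ → Ω → Erasure)
    (B : ℕ → Ω → Fin 2 → Bool) (n : ℕ) (ω : Ω) : QueueState × S × (Fin n → Input S) :=
  (Q₁ ω, St 0 ω, fun i => input St Z B (i + 1) ω)

theorem history_eq_iff {S Ω : Type*} {Q₁ : Ω → QueueState} {St : ℕ → Ω → S} {Z : ℕ → Ω → Erasure}
    {B : ℕ → Ω → Fin 2 → Bool} {n : ℕ} {ω ω' : Ω} :
    history Q₁ St Z B n ω = history Q₁ St Z B n ω' ↔ Q₁ ω = Q₁ ω' ∧ St 0 ω = St 0 ω' ∧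
      ∀ t < n, St (t + 1) ω = St (t + 1) ω' ∧ Z (t + 1) ω = Z (t + 1) ω' ∧
        B (t + 1) ω = B (t + 1) ω' := by
  simp only [history, input, Prod.mk.injEq, funext_iff (α := Fin n), Fin.forall_iff]

section System

variable {S : Type*} [Fintype S] [DecidableEq S] {ch : Channel S} {R : Fin 2 → ℝ}
  {Ω : Type*} [MeasurableSpace Ω] {μ : Measure Ω} {Q₁ : Ω → QueueState}
  {St : ℕ → Ω → S} {Z : ℕ → Ω → Erasure} {B : ℕ → Ω → Fin 2 → Bool}

namespace IsSystem

theorem measurableSet_input (hsys : IsSystem ch R μ Q₁ St Z B) (t : ℕ) (y : Input S) :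
    MeasurableSet {ω | input St Z B t ω = y} := by
  obtain ⟨s, z, b⟩ := y
  simp only [input, Prod.mk.injEq]
  exact (hsys.measurable_St t s).inter ((hsys.measurable_Z t z).inter (hsys.measurable_B t b))

theorem measurableSet_history (hsys : IsSystem ch R μ Q₁ St Z B) (n : ℕ)
    (x : QueueState × S × (Fin n → Input S)) :
    MeasurableSet {ω | history Q₁ St Z B n ω = x} := by
  obtain ⟨q, s, y⟩ := x
  simp only [history, Prod.mk.injEq, funext_iff (α := Fin n)]
  refine (hsys.measurable_Q₁ q).inter ((hsys.measurable_St 0 s).inter ?_)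
  have hInter : {ω | ∀ i : Fin n, input St Z B (i + 1) ω = y i} =
      ⋂ i : Fin n, {ω | input St Z B (i + 1) ω = y i} := by
    ext ω
    simp
  have hmeas : MeasurableSet {ω | ∀ i : Fin n, input St Z B (i + 1) ω = y i} :=
    hInter ▸ MeasurableSet.iInter fun i => hsys.measurableSet_input (i + 1) (y i)
  exact hmeas

/-- The arrival probabilities lie in `[0, 1]` because the law of the first slot has no negative
values. -/
theorem rate_mem [IsProbabilityMeasure μ] (hsys : IsSystem ch R μ Q₁ St Z B) (j : Fin 2) :
    0 ≤ R j ∧ R j ≤ 1 := by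
  obtain ⟨q, hq⟩ : ∃ q, 0 < μ.real {ω | Q₁ ω = q} := by
    by_contra! hcon
    have h0 : ∀ q, μ {ω | Q₁ ω = q} = 0 := fun q =>
      (measureReal_eq_zero_iff).1 (le_antisymm (hcon q) measureReal_nonneg)
    have h1 := lintegral_comp_eq_tsum (μ := μ) hsys.measurable_Q₁ fun _ => 1
    simp [h0] at h1
  have hpos : ∀ {f : S → ℝ}, ∑ s, f s = 1 → ∃ s, 0 < f s := by
    intro f hf
    by_contra! hcon
    linarith [Finset.sum_nonpos fun s (_ : s ∈ Finset.univ) => hcon s]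
  obtain ⟨s₀, hs₀⟩ := hpos ch.π_mem.2
  obtain ⟨s₁, hs₁⟩ := hpos (Matrix.sum_row_of_mem_rowStochastic ch.stochastic s₀)
  obtain ⟨z, hz⟩ : ∃ z, 0 < ch.W s₁ z := by
    by_contra! hcon
    linarith [Finset.sum_nonpos fun z (_ : z ∈ Finset.univ) => hcon z, (ch.W_mem s₁).2]
  have hb : ∀ b : Fin 2 → Bool, 0 ≤ ∏ j : Fin 2, (if b j = true then R j else 1 - R j) := by
    intro b
    have h := hsys.law 1 q (fun t => if t = 0 then s₀ else s₁) (fun _ => z) (fun _ => b)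
    rw [Finset.prod_range_one] at h
    have h' := h ▸ measureReal_nonneg (μ := μ)
    simp only [↓reduceIte, zero_add, one_ne_zero] at h'
    exact (mul_nonneg_iff_of_pos_left (mul_pos hs₁ hz)).1
      ((mul_nonneg_iff_of_pos_left (mul_pos hq hs₀)).1 h')
  have htt := hb ![true, true]
  have htf := hb ![true, false]
  have hft := hb ![false, true]
  have hff := hb ![false, false]
  simp [Fin.prod_univ_two] at htt htf hft hff
  fin_cases j
  · constructor
    · change 0 ≤ R 0; nlinarith
    · change R 0 ≤ 1; nlinarith
  · constructor
    · change 0 ≤ R 1; nlinarith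
    · change R 1 ≤ 1; nlinarith

/-- Given the history, the next input depends on the last channel state only. -/
theorem measure_history_input [IsProbabilityMeasure μ] (hsys : IsSystem ch R μ Q₁ St Z B)
    (n : ℕ) (ω₀ : Ω) (y : Input S) :
    μ {ω | history Q₁ St Z B n ω = history Q₁ St Z B n ω₀ ∧ input St Z B (n + 1) ω = y} =
      μ {ω | history Q₁ St Z B n ω = history Q₁ St Z B n ω₀} *
        ENNReal.ofReal (inputProb ch R (St n ω₀) y) := by
  obtain ⟨s', z', b'⟩ := y
  let s : ℕ → S := fun t => if t ≤ n then St t ω₀ else s'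
  let z : ℕ → Erasure := fun t => if t ≤ n then Z t ω₀ else z'
  let b : ℕ → Fin 2 → Bool := fun t => if t ≤ n then B t ω₀ else b'
  have hset : {ω | history Q₁ St Z B n ω = history Q₁ St Z B n ω₀} =
      {ω | Q₁ ω = Q₁ ω₀ ∧ St 0 ω = s 0 ∧ ∀ t < n,
        St (t + 1) ω = s (t + 1) ∧ Z (t + 1) ω = z (t + 1) ∧ B (t + 1) ω = b (t + 1)} := by
    ext ω
    rw [Set.mem_ofPred_eq, history_eq_iff]
    refine and_congr Iff.rfl (and_congr (by simp [s]) (forall₂_congr fun t ht => ?_))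
    simp [s, z, b, Nat.succ_le_of_lt ht]
  have hset' : {ω | history Q₁ St Z B n ω = history Q₁ St Z B n ω₀ ∧
      input St Z B (n + 1) ω = (s', z', b')} =
      {ω | Q₁ ω = Q₁ ω₀ ∧ St 0 ω = s 0 ∧ ∀ t < n + 1,
        St (t + 1) ω = s (t + 1) ∧ Z (t + 1) ω = z (t + 1) ∧ B (t + 1) ω = b (t + 1)} := by
    ext ω
    have h := Set.ext_iff.1 hset ω
    simp only [Set.mem_ofPred_eq] at h ⊢
    rw [h, Nat.forall_lt_succ_right]
    simp [input, s, z, b, and_assoc]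
  rw [hset, hset', ← ENNReal.ofReal_toReal (measure_ne_top μ _),
    ← ENNReal.ofReal_toReal (measure_ne_top μ {ω | Q₁ ω = Q₁ ω₀ ∧ St 0 ω = s 0 ∧ ∀ t < n,
      St (t + 1) ω = s (t + 1) ∧ Z (t + 1) ω = z (t + 1) ∧ B (t + 1) ω = b (t + 1)}),
    ← ENNReal.ofReal_mul ENNReal.toReal_nonneg]
  have h1 := hsys.law (n + 1) (Q₁ ω₀) s z b
  have h0 := hsys.law n (Q₁ ω₀) s z b
  rw [Finset.prod_range_succ, ← mul_assoc, ← h0] at h1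
  simp only [measureReal_def] at h1
  rw [h1]
  simp [inputProb, s, z, b]

/-- The mean of a function of the queue and channel states after a slot is that of its
conditional mean given these states before the slot. -/
theorem lintegral_queue_succ [IsProbabilityMeasure μ] (hsys : IsSystem ch R μ Q₁ St Z B)
    (act : QueueState → S → Action) {U : QueueState → S → ℝ} (hU : ∀ q s, 0 ≤ U q s) (n : ℕ) :
    ∫⁻ ω, ENNReal.ofReal (U (queue act (Q₁ ω) (fun i => St i ω) (fun i => Z i ω)
        (fun i => B i ω) (n + 2)) (St (n + 1) ω)) ∂μ =
      ∫⁻ ω, ENNReal.ofReal (slotMean ch R (St n ω) fun y => U (nextQueue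
        (queue act (Q₁ ω) (fun i => St i ω) (fun i => Z i ω) (fun i => B i ω) (n + 1))
        (act (queue act (Q₁ ω) (fun i => St i ω) (fun i => Z i ω) (fun i => B i ω) (n + 1))
          (St n ω)) y.2.1 y.2.2) y.1) ∂μ := by
  have hne : Nonempty (QueueState × S) := by
    obtain ⟨ω⟩ : Nonempty Ω := nonempty_of_isProbabilityMeasure μ
    exact ⟨(Q₁ ω, St 0 ω)⟩
  -- The queue and channel states are read off from the history by a function `F`.
  obtain ⟨F, hF⟩ : ∃ F, (fun ω => (queue act (Q₁ ω) (fun i => St i ω) (fun i => Z i ω)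
      (fun i => B i ω) (n + 1), St n ω)) = F ∘ history Q₁ St Z B n := by
    refine (Function.factorsThrough_iff _).1 fun ω ω' h => ?_
    obtain ⟨hq, hs, ht⟩ := history_eq_iff.1 h
    refine Prod.ext ?_ ?_
    · simp only [hq]
      exact queue_congr act _ n hs ht
    · cases n with
      | zero => exact hs
      | succ m => exact (ht m (Nat.lt_succ_self m)).1
  have hF1 : ∀ ω, queue act (Q₁ ω) (fun i => St i ω) (fun i => Z i ω)
      (fun i => B i ω) (n + 1) = (F (history Q₁ St Z B n ω)).1 := fun ω =>
    congrArg Prod.fst (congrFun hF ω)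
  have hF2 : ∀ ω, St n ω = (F (history Q₁ St Z B n ω)).2 := fun ω =>
    congrArg Prod.snd (congrFun hF ω)
  have hlaw : ∀ x y, μ {ω | history Q₁ St Z B n ω = x ∧ input St Z B (n + 1) ω = y} =
      μ {ω | history Q₁ St Z B n ω = x} * ENNReal.ofReal (inputProb ch R (F x).2 y) := by
    intro x y
    by_cases hx : ∃ ω₀, history Q₁ St Z B n ω₀ = x
    · obtain ⟨ω₀, rfl⟩ := hx
      rw [hsys.measure_history_input, hF2]
    · push Not at hx
      simp [hx]
  have key := lintegral_eq_lintegral_sum_of_condLaw (hsys.measurableSet_history n)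
    (hsys.measurableSet_input (n + 1)) hlaw fun x y =>
      ENNReal.ofReal (U (nextQueue (F x).1 (act (F x).1 (F x).2) y.2.1 y.2.2) y.1)
  simp only [← hF1, ← hF2] at key
  refine key.trans (lintegral_congr fun ω => ?_)
  have hK := inputProb_nonneg ch hsys.rate_mem
  rw [slotMean, ENNReal.ofReal_sum_of_nonneg fun y _ => mul_nonneg (hK _ y) (hU _ _)]
  exact Finset.sum_congr rfl fun y _ => (ENNReal.ofReal_mul (hK _ y)).symm

end IsSystem

end System

/-! ### From drift to strong stability -/

/-- Summing a drift inequality `E (n + 1) + x n ≤ E n + K` over time bounds the averages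
of `x`. -/
theorem sum_range_le_of_drift {E x : ℕ → ℝ≥0∞} {K : ℝ≥0∞}
    (h : ∀ n, E (n + 1) + x n ≤ E n + K) (n : ℕ) :
    ∑ t ∈ Finset.range n, x t ≤ E 0 + n * K := by
  suffices hs : E n + ∑ t ∈ Finset.range n, x t ≤ E 0 + n * K from le_add_self.trans hs
  induction n with
  | zero => simp
  | succ n ih =>
    calc E (n + 1) + ∑ t ∈ Finset.range (n + 1), x t
        = (E (n + 1) + x n) + ∑ t ∈ Finset.range n, x t := by rw [Finset.sum_range_succ]; ring
      _ ≤ (E n + K) + ∑ t ∈ Finset.range n, x t := add_le_add (h n) le_rfl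
      _ = (E n + ∑ t ∈ Finset.range n, x t) + K := by ring
      _ ≤ (E 0 + n * K) + K := by gcongr
      _ = E 0 + (n + 1 : ℕ) * K := by push_cast; ring

theorem stronglyStable_of_drift {Ω : Type*} [MeasurableSpace Ω] {μ : Measure Ω} {X : ℕ → Ω → ℕ}
    {E : ℕ → ℝ≥0∞} {ε K : ℝ≥0∞} (hε : ε ≠ 0) (hε' : ε ≠ ⊤) (hK : K ≠ ⊤) (hE : E 0 ≠ ⊤)
    (h : ∀ n, E (n + 1) + ε * ∫⁻ ω, (X (n + 1) ω : ℝ≥0∞) ∂μ ≤ E n + K) :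
    StronglyStable μ X := by
  have hbound : ∀ n : ℕ, 1 ≤ n →
      (∑ t ∈ Finset.Icc 1 n, ∫⁻ ω, (X t ω : ℝ≥0∞) ∂μ) / (n : ℝ≥0∞) ≤ (E 0 + K) / ε := by
    intro n hn
    have hn1 : (1 : ℝ≥0∞) ≤ n := by exact_mod_cast hn
    have hn0 : (n : ℝ≥0∞) ≠ 0 := by positivity
    have hsum := sum_range_le_of_drift h n
    rw [← Finset.mul_sum] at hsum
    have hidx : ∑ t ∈ Finset.Icc 1 n, ∫⁻ ω, (X t ω : ℝ≥0∞) ∂μ =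
        ∑ t ∈ Finset.range n, ∫⁻ ω, (X (t + 1) ω : ℝ≥0∞) ∂μ := by
      rw [← Finset.Ico_add_one_right_eq_Icc, Finset.sum_Ico_eq_sum_range]
      simp [add_comm]
    rw [hidx, ENNReal.div_le_iff hn0 (ENNReal.natCast_ne_top n), ← ENNReal.mul_div_right_comm,
      ENNReal.le_div_iff_mul_le (Or.inl hε) (Or.inl hε'), mul_comm]
    refine hsum.trans ?_
    rw [add_mul, mul_comm K]
    gcongr
    exact le_mul_of_one_le_right' hn1
  refine lt_of_le_of_lt (limsup_le_of_le (by isBoundedDefault)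
    (eventually_atTop.2 ⟨1, hbound⟩)) ?_
  exact ENNReal.div_lt_top (ENNReal.add_ne_top.2 ⟨hE, hK⟩) hε

end ErasureBroadcast

theorem mainTheorem3 {S : Type*} [Fintype S] [DecidableEq S]
    (ch : ErasureBroadcast.Channel S)
    (act : ErasureBroadcast.QueueState → S → ErasureBroadcast.Action)
    (hact : ErasureBroadcast.IsMaxWeight ch act)
    (R : Fin 2 → ℝ) (δ : ℝ) (hδ : 0 < δ)
    (hR : (R 0 + δ, R 1 + δ) ∈ ch.region)
    {Ω : Type*} [MeasurableSpace Ω] (μ : MeasureTheory.Measure Ω)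
    [MeasureTheory.IsProbabilityMeasure μ]
    (Q₁ : Ω → ErasureBroadcast.QueueState) (St : ℕ → Ω → S)
    (Z : ℕ → Ω → ErasureBroadcast.Erasure) (B : ℕ → Ω → Fin 2 → Bool)
    (hsys : ErasureBroadcast.IsSystem ch R μ Q₁ St Z B)
    (hQ₁ : ∀ j l, ∫⁻ ω, (Q₁ ω j l : ENNReal) ^ 2 ∂μ < ⊤) :
    ∀ (j : Fin 2) (l : ErasureBroadcast.Buffer),
      ErasureBroadcast.StronglyStable μ
        (fun t ω => ErasureBroadcast.queue act (Q₁ ω) (fun i => St i ω) (fun i => Z i ω)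
          (fun i => B i ω) t j l) := by
  intro j l
  obtain ⟨U, ε, K, C, hε, hK, hC, hU0, hUC, hdrift⟩ :=
    ErasureBroadcast.exists_lyapunov ch hsys.rate_mem hδ hR hact
  let q : ℕ → Ω → ErasureBroadcast.QueueState := fun t ω =>
    ErasureBroadcast.queue act (Q₁ ω) (fun i => St i ω) (fun i => Z i ω) (fun i => B i ω) t
  let E : ℕ → ℝ≥0∞ := fun n => ∫⁻ ω, ENNReal.ofReal (U (q (n + 1) ω) (St n ω)) ∂μ
  refine ErasureBroadcast.stronglyStable_of_drift (E := E) (ε := ENNReal.ofReal ε)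
    (K := ENNReal.ofReal K) (ENNReal.ofReal_pos.2 hε).ne' ENNReal.ofReal_ne_top
    ENNReal.ofReal_ne_top ?_ fun n => ?_
  · -- The initial value of the Lyapunov function is integrable by the second moments.
    have hle : E 0 ≤ ∫⁻ ω, ENNReal.ofReal C * ∑ j, ∑ l, (Q₁ ω j l : ℝ≥0∞) ^ 2 ∂μ := by
      refine lintegral_mono fun ω => (ENNReal.ofReal_le_ofReal (hUC _ _)).trans_eq ?_
      rw [ENNReal.ofReal_mul hC, ErasureBroadcast.sumSq, ENNReal.ofReal_sum_of_nonneg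
        fun j _ => Finset.sum_nonneg fun l _ => sq_nonneg _]
      congr 1
      refine Finset.sum_congr rfl fun j _ => ?_
      rw [ENNReal.ofReal_sum_of_nonneg fun l _ => sq_nonneg _]
      refine Finset.sum_congr rfl fun l _ => ?_
      rw [ENNReal.ofReal_pow (Nat.cast_nonneg _), ENNReal.ofReal_natCast]
      rfl
    have hm : ∀ j l, Measurable fun ω => (Q₁ ω j l : ℝ≥0∞) ^ 2 := fun j l =>
      ErasureBroadcast.measurable_comp_of_fibers hsys.measurable_Q₁
        fun q => (q j l : ℝ≥0∞) ^ 2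
    refine (hle.trans_lt ?_).ne
    rw [lintegral_const_mul' _ _ ENNReal.ofReal_ne_top, lintegral_finsetSum _ fun j _ =>
      Finset.measurable_sum _ fun l _ => hm j l]
    refine ENNReal.mul_lt_top ENNReal.ofReal_lt_top (ENNReal.sum_lt_top.2 fun j _ => ?_)
    rw [lintegral_finsetSum _ fun l _ => hm j l]
    exact ENNReal.sum_lt_top.2 fun l _ => hQ₁ j l
  · have hstep : E (n + 1) = _ := hsys.lintegral_queue_succ act hU0 n
    rw [hstep, ← lintegral_const_mul' _ _ ENNReal.ofReal_ne_top]
    refine (le_lintegral_add _ _).trans ?_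
    have hconst : E n + ENNReal.ofReal K =
        ∫⁻ ω, (ENNReal.ofReal (U (q (n + 1) ω) (St n ω)) + ENNReal.ofReal K) ∂μ := by
      rw [lintegral_add_right _ measurable_const, lintegral_const, measure_univ, mul_one]
    rw [hconst]
    refine lintegral_mono fun ω => ?_
    have hsingle : (q (n + 1) ω j l : ℝ) ≤ ∑ j, ∑ l, (q (n + 1) ω j l : ℝ) :=
      (Finset.single_le_sum (f := fun l => (q (n + 1) ω j l : ℝ))
        (fun l _ => Nat.cast_nonneg _) (Finset.mem_univ l)).trans
      (Finset.single_le_sum (f := fun j => ∑ l, (q (n + 1) ω j l : ℝ))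
        (fun j _ => Finset.sum_nonneg fun l _ => Nat.cast_nonneg _) (Finset.mem_univ j))
    have hmean0 : 0 ≤ ErasureBroadcast.slotMean ch R (St n ω) fun y =>
        U (ErasureBroadcast.nextQueue (q (n + 1) ω) (act (q (n + 1) ω) (St n ω)) y.2.1 y.2.2)
          y.1 :=
      Finset.sum_nonneg fun y _ =>
        mul_nonneg (ErasureBroadcast.inputProb_nonneg ch hsys.rate_mem _ y) (hU0 _ _)
    have hd := hdrift (q (n + 1) ω) (St n ω)
    have hs := mul_le_mul_of_nonneg_left hsingle hε.le
    rw [← ENNReal.ofReal_natCast, ← ENNReal.ofReal_mul hε.le, ← ENNReal.ofReal_add (hU0 _ _) hK,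
      ← ENNReal.ofReal_add hmean0 (mul_nonneg hε.le (Nat.cast_nonneg _))]
    exact ENNReal.ofReal_le_ofReal (by linarith)
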